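/- Let $\mathbb{D}=\{z\in\mathbb{C}:|z|<1\}$ and let $dA(z)=\pi^{-1}\,dx\,dy$ for $z=x+iy$. Let $H^\infty$ be the space of bounded holomorphic functions $f$ on $\mathbb{D}$, with norm $\|f\|_\infty=\sup_{z\in\mathbb{D}}|f(z)|$. Let $H^2$ be the Hardy space of holomorphic functions $f$ on $\mathbb{D}$ with $\sup_{0\le r<1}\frac1{2\pi}\int_0^{2\pi}|f(re^{i\theta})|^2\,d\theta<\infty$, and let $\mathrm{BMOA}$ be the space of all $f\in H^2$ such that $$\|f\|_{\mathrm{BMOA}}=|f(0)|+\left(\sup_{a\in\mathbb{D}}\int_{\mathbb{D}}|f'(z)|^2\log\left|\frac{1-\overline{a}z}{a-z}\right|^2dA(z)\right)^{1/2}<\infty .$$ For $f(z)=\sum_{k=0}^\infty a_kz^k$ in $H^\infty$, the Hilbert matrix operator is $$\mathcal{H}(f)(z)=\sum_{n=0}^\infty\left(\sum_{k=0}^\infty\frac{a_k}{k+n+1}\right)z^n,\qquad z\in\mathbb{D}.$$ **Theorem.** For every $f\in H^\infty$ the series defining $\mathcal{H}(f)$ converge absolutely (the inner ones for every $n\ge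 0$, the outer one for every $z\in\mathbb{D}$), and $\mathcal{H}(f)\in\mathrm{BMOA}$. Moreover the norm of $\mathcal{H}:H^\infty\to\mathrm{BMOA}$, that is, the least constant $C$ such that $\|\mathcal{H}(f)\|_{\mathrm{BMOA}}\le C\|f\|_\infty$ for all $f\in H^\infty$, is $$\|\mathcal{H}\|_{H^\infty\to\mathrm{BMOA}}=1+\frac{\pi}{\sqrt2}.$$ -/

import Mathlib

open MeasureTheory Metric Set
open scoped ENNReal ComplexConjugate

noncomputable section

namespace HilbertBMOA

/- Functions on the open unit disc `ball 0 1` are represented by functions `ℂ → ℂ`; all the notions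
below only depend on the values in the (open) disc. Norms take values in
`[0, ∞]`, so that no convention for divergent integrals or unbounded suprema is involved. -/

/-- `Hol(𝔻)`: holomorphic functions in the open unit disc. -/
def Hol (f : ℂ → ℂ) : Prop :=
  DifferentiableOn ℂ f (ball (0 : ℂ) 1)

/-- The supremum norm `‖f‖_∞ = sup_{z ∈ 𝔻} |f(z)|`. -/
def hInfNorm (f : ℂ → ℂ) : ℝ≥0∞ :=
  ⨆ z ∈ ball (0 : ℂ) 1, ‖f z‖ₑ

/-- `f ∈ H^∞`: bounded holomorphic functions in the disc. -/
def MemHInf (f : ℂ → ℂ) : Prop :=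
  Hol f ∧ hInfNorm f < ∞

/-- The integral mean `M_p(r, f) = ((2π)⁻¹ ∫_0^{2π} |f(r e^{iθ})|^p dθ)^{1/p}`. -/
def integralMean (p r : ℝ) (f : ℂ → ℂ) : ℝ≥0∞ :=
  ((ENNReal.ofReal (2 * Real.pi))⁻¹ *
    ∫⁻ θ in Ioc (0 : ℝ) (2 * Real.pi),
      ‖f ((r : ℂ) * Complex.exp ((θ : ℂ) * Complex.I))‖ₑ ^ p) ^ (1 / p)

/-- The Hardy norm `‖f‖_{H^p} = sup_{0 ≤ r < 1} M_p(r, f)`. -/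
def hardyNorm (p : ℝ) (f : ℂ → ℂ) : ℝ≥0∞ :=
  ⨆ r ∈ Ico (0 : ℝ) 1, integralMean p r f

/-- `f ∈ H^p` (used for `1 ≤ p < ∞`). -/
def MemHardy (p : ℝ) (f : ℂ → ℂ) : Prop :=
  Hol f ∧ hardyNorm p f < ∞

/-- The normalized area measure `dA = π⁻¹ dx dy` on the unit disc. -/
def diskArea : Measure ℂ :=
  (ENNReal.ofReal Real.pi)⁻¹ • (volume : Measure ℂ).restrict (ball (0 : ℂ) 1)

/-- `∫_𝔻 |f'(z)|² log |(1 - ā z)/(a - z)|² dA(z)`. The logarithm is nonnegative for `a, z ∈ 𝔻`,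
`z ≠ a`, so `ENNReal.ofReal` truncates nothing. -/
def greenIntegral (f : ℂ → ℂ) (a : ℂ) : ℝ≥0∞ :=
  ∫⁻ z, ‖deriv f z‖ₑ ^ 2 *
    ENNReal.ofReal (Real.log (‖(1 - conj a * z) / (a - z)‖ ^ 2)) ∂diskArea

/-- The norm of `BMOA`:
`|f(0)| + (sup_{a ∈ 𝔻} ∫_𝔻 |f'(z)|² log |(1 - ā z)/(a - z)|² dA(z))^{1/2}`. -/
def bmoaNorm (f : ℂ → ℂ) : ℝ≥0∞ :=
  ‖f 0‖ₑ + (⨆ a ∈ ball (0 : ℂ) 1, greenIntegral f a) ^ (1 / 2 : ℝ)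

/-- `f ∈ BMOA`: functions in the Hardy space `H²` of finite `BMOA` norm. -/
def MemBMOA (f : ℂ → ℂ) : Prop :=
  MemHardy 2 f ∧ bmoaNorm f < ∞

/-- The `k`-th Taylor coefficient of `f` at the origin. -/
def taylorCoeff (f : ℂ → ℂ) (k : ℕ) : ℂ :=
  iteratedDeriv k f 0 / (k.factorial : ℂ)

/-- The terms `a_k / (k + n + 1)` of the `n`-th entry of the Hilbert matrix applied to the sequence
of Taylor coefficients of `f`. -/
def hilbertTerm (f : ℂ → ℂ) (n k : ℕ) : ℂ :=
  taylorCoeff f k / ((k : ℂ) + (n : ℂ) + 1)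

/-- The `n`-th Taylor coefficient `∑_k a_k / (k + n + 1)` of `H(f)`. -/
def hilbertCoeff (f : ℂ → ℂ) (n : ℕ) : ℂ :=
  ∑' k : ℕ, hilbertTerm f n k

/-- The Hilbert matrix operator `H(f)(z) = ∑_n (∑_k a_k / (k + n + 1)) z^n`. -/
def hilbertOp (f : ℂ → ℂ) (z : ℂ) : ℂ :=
  ∑' n : ℕ, hilbertCoeff f n * z ^ n

/-- The operator norm, from `H^∞` to `BMOA`, of `T`: the least `C ∈ [0, ∞]` such that
`‖T f‖_BMOA ≤ C ‖f‖_∞` for all `f ∈ H^∞`. -/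
def opNormHInfBMOA (T : (ℂ → ℂ) → ℂ → ℂ) : ℝ≥0∞ :=
  sInf {C : ℝ≥0∞ | ∀ f : ℂ → ℂ, MemHInf f → bmoaNorm (T f) ≤ C * hInfNorm f}

end HilbertBMOA

end

noncomputable section

namespace HilbertBMOA

open Filter Topology

/-! Write `M` for the supremum norm of `f`. Termwise integration gives H(f)'(z) = ∫₀¹ s f(s) / (1 -
sz)² ds. Replacing the segment by the curve ζ = t / (1 - (1 - t)z), which stays in the disc and
satisfies dζ / (1 - ζz)² = dt / (1 - z), yields |H(f)'(z)| ≤ M / |1 - z|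
(`norm_deriv_hilbertOp_le`). So H(f) is dominated by log(1/(1 - z)), whose Green integrals are
explicit: after a Möbius change of variables, the Littlewood–Paley identity turns the one at `a`
into ∑ |1 - c^(n+1)|² / (n+1)² with |c| = |a| (`lintegral_inv_one_sub_greenWeight`). For c =
e^{2πix} this sum is 2π²x(1 - x) ≤ π²/2, and the maximum principle extends the bound to |c| ≤ 1.
With |H(f)(0)| = |∫₀¹ f| ≤ M this gives the upper bound 1 + π/√2.

Equality comes from f = 1. Then H(1)(0) = 1, and (1 - z) H(1)'(z) extends continuously to the closed
disc with value 1 at z = 1. Up to a factor near 1 and an additive constant, |H(1)'|² is thus at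
least |1 - z|⁻². As a = r → 1⁻ the constant contributes nothing (its Green integral is a multiple of
1 - r²), while c = -r → -1, the point x = 1/2 where π²/2 is attained
(`le_iSup_greenIntegral_hilbertOp_one`). -/

/-! ### Parseval's identity on circles -/

/-- Parseval's identity on the unit circle for absolutely convergent power series. -/
lemma hasSum_norm_sq_circleAverage (d : ℕ → ℂ) (hd : Summable fun n => ‖d n‖) :
    HasSum (fun n => ‖d n‖ ^ 2)
      (Real.circleAverage (fun w => ‖∑' n, d n * w ^ n‖ ^ 2) 0 1) := by
  rw [hasSum_iff_tendsto_nat_of_nonneg (fun n => by positivity)]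
  have key : ∀ N : ℕ, ∑ n ∈ Finset.range N, ‖d n‖ ^ 2 =
      Real.circleAverage (fun w => ‖∑ n ∈ Finset.range N, d n * w ^ n‖ ^ 2) 0 1 := by
    intro N
    have h := Polynomial.sum_sq_norm_coeff_eq_circleAverage
      (∑ n ∈ Finset.range N, Polynomial.C (d n) * Polynomial.X ^ n)
    have hc : ∀ i, (∑ n ∈ Finset.range N, Polynomial.C (d n) * Polynomial.X ^ n).coeff i
        = if i < N then d i else 0 := by
      intro i
      simp [Polynomial.finsetSum_coeff, Polynomial.coeff_C_mul, Polynomial.coeff_X_pow]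
    rw [Finset.sum_subset (s₂ := Finset.range N)] at h
    · simp only [Polynomial.eval_finsetSum, Polynomial.eval_mul, Polynomial.eval_C,
        Polynomial.eval_pow, Polynomial.eval_X] at h
      rw [← h]
      refine Finset.sum_congr rfl fun i hi => ?_
      rw [hc, if_pos (Finset.mem_range.1 hi)]
    · intro i hi
      rw [Polynomial.mem_support_iff, hc] at hi
      rw [Finset.mem_range]
      by_contra hcon
      simp [hcon] at hi
    · intro i _ hi
      rw [Polynomial.notMem_support_iff] at hi
      rw [hi]; simp
  simp_rw [key, Real.circleAverage_def]
  refine Tendsto.const_smul ?_ _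
  refine intervalIntegral.tendsto_integral_filter_of_dominated_convergence
    (fun _ => (∑' n, ‖d n‖) ^ 2) ?_ ?_ ?_ ?_
  · refine Eventually.of_forall fun N => ?_
    refine Continuous.aestronglyMeasurable ?_
    have : Continuous (circleMap 0 1) := continuous_circleMap 0 1
    fun_prop
  · refine Eventually.of_forall fun N => Eventually.of_forall fun θ _ => ?_
    rw [Real.norm_of_nonneg (by positivity)]
    gcongr
    refine (norm_sum_le _ _).trans ?_
    simp only [norm_mul, norm_pow, norm_circleMap_zero, abs_one, one_pow, mul_one]
    exact hd.sum_le_tsum _ (fun i _ => norm_nonneg _)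
  · exact intervalIntegrable_const
  · refine Eventually.of_forall fun θ _ => ?_
    have hs : Summable fun n => d n * circleMap 0 1 θ ^ n := by
      refine Summable.of_norm ?_
      simpa using hd
    exact (hs.hasSum.tendsto_sum_nat.norm.pow 2)

lemma lintegral_circle_eq (g : ℂ → ℂ) (r : ℝ)
    (hg : Continuous fun θ : ℝ => g (circleMap 0 r θ)) :
    ∫⁻ θ in Ioc 0 (2 * Real.pi), ‖g (circleMap 0 r θ)‖ₑ ^ 2 =
      ENNReal.ofReal (2 * Real.pi) *
        ENNReal.ofReal (Real.circleAverage (fun w => ‖g w‖ ^ 2) 0 r) := by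
  have hpi := Real.pi_pos
  rw [← ENNReal.ofReal_mul (by positivity), Real.circleAverage_def, smul_eq_mul, ← mul_assoc,
    mul_inv_cancel₀ (by positivity), one_mul, intervalIntegral.integral_of_le (by positivity),
    ofReal_integral_eq_lintegral_ofReal]
  · refine lintegral_congr fun θ => ?_
    rw [ENNReal.ofReal_pow (norm_nonneg _), ofReal_norm]
  · rw [← IntegrableOn, ← intervalIntegrable_iff_integrableOn_Ioc_of_le (by positivity)]
    exact (hg.norm.pow 2).intervalIntegrable _ _
  · exact Eventually.of_forall fun θ => by positivity

/-- Polar coordinates use angles in (-π, π), circle averages use (0, 2π]; periodicity reconciles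
them. -/
lemma setLIntegral_Ioo_eq_Ioc_of_circleMap (g : ℂ → ℂ) (r : ℝ)
    (hg : Continuous fun θ : ℝ => g (circleMap 0 r θ)) :
    ∫⁻ θ in Ioo (-Real.pi) Real.pi, ‖g (circleMap 0 r θ)‖ₑ ^ 2 =
      ∫⁻ θ in Ioc 0 (2 * Real.pi), ‖g (circleMap 0 r θ)‖ₑ ^ 2 := by
  have hpi := Real.pi_pos
  have hc : Continuous fun θ : ℝ => ‖g (circleMap 0 r θ)‖ ^ 2 := hg.norm.pow 2
  have aux : ∀ a b : ℝ, a ≤ b → ∫⁻ θ in Ioc a b, ‖g (circleMap 0 r θ)‖ₑ ^ 2 =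
      ENNReal.ofReal (∫ θ in a..b, ‖g (circleMap 0 r θ)‖ ^ 2) := by
    intro a b hab
    rw [intervalIntegral.integral_of_le hab, ofReal_integral_eq_lintegral_ofReal]
    · refine lintegral_congr fun θ => ?_
      rw [ENNReal.ofReal_pow (norm_nonneg _), ofReal_norm]
    · rw [← IntegrableOn, ← intervalIntegrable_iff_integrableOn_Ioc_of_le hab]
      exact hc.intervalIntegrable _ _
    · exact Eventually.of_forall fun θ => by positivity
  rw [setLIntegral_congr Ioo_ae_eq_Ioc, aux _ _ (by linarith), aux _ _ (by positivity)]
  have hp : Function.Periodic (fun θ : ℝ => ‖g (circleMap 0 r θ)‖ ^ 2) (2 * Real.pi) := by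
    intro θ
    simp only [periodic_circleMap 0 r θ]
  have := hp.intervalIntegral_add_eq (-Real.pi) 0
  rw [zero_add, show -Real.pi + 2 * Real.pi = Real.pi by ring] at this
  rw [this]

lemma summable_norm_mul_pow {k : ℂ → ℂ} {e : ℕ → ℂ}
    (hk : ∀ z ∈ ball (0 : ℂ) 1, HasSum (fun n => e n * z ^ n) (k z)) {r : ℝ}
    (hr0 : 0 ≤ r) (hr1 : r < 1) : Summable fun n => ‖e n * (r : ℂ) ^ n‖ := by
  refine Summable.norm ?_
  refine (hk (r : ℂ) ?_).summable
  simpa [abs_of_nonneg hr0] using hr1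

/-- Parseval's identity on the circle of radius `r < 1`. -/
lemma hasSum_norm_sq_circleAverage_radius {k : ℂ → ℂ} {e : ℕ → ℂ}
    (hk : ∀ z ∈ ball (0 : ℂ) 1, HasSum (fun n => e n * z ^ n) (k z)) {r : ℝ}
    (hr0 : 0 ≤ r) (hr1 : r < 1) :
    HasSum (fun n => ‖e n‖ ^ 2 * r ^ (2 * n))
      (Real.circleAverage (fun w => ‖k w‖ ^ 2) 0 r) := by
  have h := hasSum_norm_sq_circleAverage _ (summable_norm_mul_pow hk hr0 hr1)
  convert h using 1
  · ext n
    rw [norm_mul, norm_pow, Complex.norm_real, Real.norm_of_nonneg hr0]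
    ring
  · rw [Real.circleAverage_def, Real.circleAverage_def]
    congr 1
    refine intervalIntegral.integral_congr fun θ _ => ?_
    have hz : circleMap 0 r θ ∈ ball (0 : ℂ) 1 := by
      simpa [abs_of_nonneg hr0] using hr1
    rw [← (hk _ hz).tsum_eq]
    congr 3
    ext n
    simp only [circleMap, zero_add, Complex.ofReal_one, one_mul, mul_pow, mul_assoc]

lemma continuous_comp_circleMap {k : ℂ → ℂ} (hk : ContinuousOn k (ball 0 1)) {r : ℝ}
    (hr0 : 0 ≤ r) (hr1 : r < 1) : Continuous fun θ : ℝ => k (circleMap 0 r θ) := by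
  refine hk.comp_continuous (continuous_circleMap 0 r) fun θ => ?_
  simpa [abs_of_nonneg hr0] using hr1

lemma lintegral_circle_eq_tsum {k : ℂ → ℂ} {e : ℕ → ℂ} (hkc : ContinuousOn k (ball 0 1))
    (hk : ∀ z ∈ ball (0 : ℂ) 1, HasSum (fun n => e n * z ^ n) (k z)) {r : ℝ}
    (hr0 : 0 ≤ r) (hr1 : r < 1) :
    ∫⁻ θ in Ioc 0 (2 * Real.pi), ‖k (circleMap 0 r θ)‖ₑ ^ 2 =
      ENNReal.ofReal (2 * Real.pi) * ∑' n, ENNReal.ofReal (‖e n‖ ^ 2 * r ^ (2 * n)) := by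
  have h := hasSum_norm_sq_circleAverage_radius hk hr0 hr1
  rw [lintegral_circle_eq k r (continuous_comp_circleMap hkc hr0 hr1), ← h.tsum_eq,
    ENNReal.ofReal_tsum_of_nonneg (fun n => by positivity) h.summable]

/-! ### The Littlewood–Paley identity in polar coordinates -/

lemma lintegral_pow_mul_log (n : ℕ) :
    ∫⁻ r in Ioo (0 : ℝ) 1, ENNReal.ofReal (r ^ (2 * n + 1) * Real.log ((r⁻¹) ^ 2)) =
      ENNReal.ofReal (1 / (2 * ((n : ℝ) + 1) ^ 2)) := by
  have hm : ((n : ℝ) + 1) ≠ 0 := by positivity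
  -- An explicit antiderivative; the factor `r * Real.log r` is kept together because it is
  -- continuous at 0. Integrability of the derivative then follows from its sign.
  set Φ : ℝ → ℝ := fun r => -(r ^ (2 * n + 1) / (n + 1)) * (r * Real.log r) +
    r ^ (2 * n + 2) / (2 * (n + 1) ^ 2) with hΦ
  have hcont : ContinuousOn Φ (Icc 0 1) := by
    have := Real.continuous_mul_log
    refine Continuous.continuousOn ?_
    fun_prop
  have hderiv : ∀ x ∈ Ioo (0 : ℝ) 1,
      HasDerivAt Φ (x ^ (2 * n + 1) * Real.log ((x⁻¹) ^ 2)) x := by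
    intro x hx
    have hx0 : x ≠ 0 := hx.1.ne'
    have h0 : HasDerivAt (fun x : ℝ => -(x ^ (2 * n + 1) / ((n : ℝ) + 1)))
        (-(((2 * n + 1 : ℕ) : ℝ) * x ^ (2 * n) / (n + 1))) x :=
      ((hasDerivAt_pow (2 * n + 1) x).div_const ((n : ℝ) + 1)).fun_neg
    have h1 := h0.mul (Real.hasDerivAt_mul_log hx0)
    have h2 := (hasDerivAt_pow (2 * n + 2) x).div_const (2 * ((n : ℝ) + 1) ^ 2)
    refine (h1.add h2).congr_deriv ?_
    rw [Real.log_pow, Real.log_inv]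
    push_cast
    field_simp
    ring
  have hpos : ∀ x ∈ Ioo (0 : ℝ) 1, 0 ≤ x ^ (2 * n + 1) * Real.log ((x⁻¹) ^ 2) := by
    intro x hx
    have := hx.1
    refine mul_nonneg (by positivity) (Real.log_nonneg ?_)
    exact one_le_pow₀ ((one_le_inv₀ hx.1).2 hx.2.le)
  have hint := intervalIntegral.integrableOn_deriv_of_nonneg hcont hderiv hpos
  have hval := intervalIntegral.integral_eq_sub_of_hasDerivAt_of_le zero_le_one hcont hderiv
    ((intervalIntegrable_iff_integrableOn_Ioc_of_le zero_le_one).2 hint)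
  rw [intervalIntegral.integral_of_le zero_le_one] at hval
  rw [setLIntegral_congr Ioo_ae_eq_Ioc, ← ofReal_integral_eq_lintegral_ofReal hint, hval]
  · simp [hΦ]
  · rw [Filter.EventuallyLE, ← restrict_Ioo_eq_restrict_Ioc,
      ae_restrict_iff' measurableSet_Ioo]
    exact Eventually.of_forall hpos


/-- The Green weight of `𝔻` with pole at `a`. -/
def greenWeight (a z : ℂ) : ℝ≥0∞ :=
  ENNReal.ofReal (Real.log (‖(1 - conj a * z) / (a - z)‖ ^ 2))

lemma measurable_greenWeight (a : ℂ) : Measurable (greenWeight a) := by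
  unfold greenWeight
  fun_prop

lemma lintegral_diskArea (F : ℂ → ℝ≥0∞) :
    ∫⁻ z, F z ∂diskArea = (ENNReal.ofReal Real.pi)⁻¹ * ∫⁻ z in ball (0 : ℂ) 1, F z := by
  rw [diskArea, lintegral_smul_measure, smul_eq_mul]

/-- Polar coordinates and Tonelli need a globally measurable integrand, whereas `k` is controlled
only on the disc; hence the extension by zero. -/
lemma measurable_indicator_ball {k : ℂ → ℂ} (hk : ContinuousOn k (ball 0 1)) :
    Measurable ((ball (0 : ℂ) 1).indicator k) := by
  classical
  rw [← Set.piecewise_eq_indicator]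
  exact hk.measurable_piecewise continuousOn_const measurableSet_ball

lemma setLIntegral_ball_polar {F : ℂ → ℝ≥0∞} (hF : Measurable F)
    (h0 : ∀ z, z ∉ ball (0 : ℂ) 1 → F z = 0) :
    ∫⁻ z in ball (0 : ℂ) 1, F z =
      ∫⁻ r in Ioo (0 : ℝ) 1, ∫⁻ θ in Ioo (-Real.pi) Real.pi,
        ENNReal.ofReal r * F (circleMap 0 r θ) := by
  have h1 : ∫⁻ z in ball (0 : ℂ) 1, F z = ∫⁻ z, F z := by
    refine setLIntegral_eq_of_support_subset ?_
    intro z hz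
    by_contra hcon
    exact hz (h0 z hcon)
  have hsymm : ∀ p : ℝ × ℝ, Complex.polarCoord.symm p = circleMap 0 p.1 p.2 := by
    intro p
    rw [Complex.polarCoord_symm_apply, circleMap, zero_add, Complex.exp_mul_I]
    simp
  have hmeas : Measurable fun p : ℝ × ℝ => ENNReal.ofReal p.1 * F (circleMap 0 p.1 p.2) := by
    have : Continuous fun p : ℝ × ℝ => circleMap 0 p.1 p.2 := by
      unfold circleMap
      fun_prop
    exact (by fun_prop : Measurable fun p : ℝ × ℝ => ENNReal.ofReal p.1).mul
      (hF.comp this.measurable)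
  rw [h1, ← Complex.lintegral_comp_polarCoord_symm]
  simp only [hsymm, smul_eq_mul]
  rw [polarCoord_target, Measure.volume_eq_prod, ← Measure.prod_restrict,
    lintegral_prod _ hmeas.aemeasurable]
  rw [← Ioo_union_Ici_eq_Ioi (zero_lt_one' ℝ), lintegral_union measurableSet_Ici
    (Set.disjoint_left.2 fun x hx hx' => not_lt.2 hx' hx.2),
    setLIntegral_eq_zero measurableSet_Ici, add_zero]
  intro r hr
  have : ∀ θ : ℝ, F (circleMap 0 r θ) = 0 := by
    intro θ
    apply h0
    have hr' : (1 : ℝ) ≤ r := hr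
    simpa [abs_of_nonneg (zero_le_one.trans hr')] using hr'
  simp [this]

/-- The Littlewood–Paley identity, for the derivative given by its power series. -/
lemma lintegral_greenWeight_zero {k : ℂ → ℂ} {e : ℕ → ℂ} (hkc : ContinuousOn k (ball 0 1))
    (hk : ∀ z ∈ ball (0 : ℂ) 1, HasSum (fun n => e n * z ^ n) (k z)) :
    ∫⁻ z, ‖k z‖ₑ ^ 2 * greenWeight 0 z ∂diskArea =
      ∑' n, ENNReal.ofReal (‖e n‖ ^ 2 / ((n : ℝ) + 1) ^ 2) := by
  have hpi := Real.pi_pos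
  set k' := (ball (0 : ℂ) 1).indicator k with hk'
  have hmeas : Measurable k' := measurable_indicator_ball hkc
  rw [lintegral_diskArea]
  have h1 : ∫⁻ z in ball (0 : ℂ) 1, ‖k z‖ₑ ^ 2 * greenWeight 0 z =
      ∫⁻ z in ball (0 : ℂ) 1, ‖k' z‖ₑ ^ 2 * greenWeight 0 z := by
    refine setLIntegral_congr_fun measurableSet_ball fun z hz => ?_
    simp only [hk', indicator_of_mem hz]
  rw [h1, setLIntegral_ball_polar (F := fun z => ‖k' z‖ₑ ^ 2 * greenWeight 0 z)
    ((hmeas.enorm.pow_const 2).mul (measurable_greenWeight 0))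
    (fun z hz => by simp [hk', indicator_of_notMem hz])]
  have h2 : ∀ r ∈ Ioo (0 : ℝ) 1, ∫⁻ θ in Ioo (-Real.pi) Real.pi,
      ENNReal.ofReal r * (‖k' (circleMap 0 r θ)‖ₑ ^ 2 * greenWeight 0 (circleMap 0 r θ)) =
      ∑' n, ENNReal.ofReal (2 * Real.pi * ‖e n‖ ^ 2) *
        ENNReal.ofReal (r ^ (2 * n + 1) * Real.log ((r⁻¹) ^ 2)) := by
    intro r hr
    have hr0 := hr.1
    have hlog : 0 ≤ Real.log ((r⁻¹) ^ 2) :=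
      Real.log_nonneg (one_le_pow₀ ((one_le_inv₀ hr.1).2 hr.2.le))
    have h3 : ∀ θ : ℝ,
        ENNReal.ofReal r * (‖k' (circleMap 0 r θ)‖ₑ ^ 2 * greenWeight 0 (circleMap 0 r θ)) =
        ENNReal.ofReal (r * Real.log ((r⁻¹) ^ 2)) * ‖k (circleMap 0 r θ)‖ₑ ^ 2 := by
      intro θ
      have hz : circleMap 0 r θ ∈ ball (0 : ℂ) 1 := by
        simpa [abs_of_nonneg hr0.le] using hr.2
      have hw : greenWeight 0 (circleMap 0 r θ) = ENNReal.ofReal (Real.log ((r⁻¹) ^ 2)) := by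
        simp [greenWeight, abs_of_nonneg hr0.le]
      rw [hk', indicator_of_mem hz, hw, ENNReal.ofReal_mul hr0.le]
      ring
    simp_rw [h3]
    rw [lintegral_const_mul' _ _ ENNReal.ofReal_ne_top,
      setLIntegral_Ioo_eq_Ioc_of_circleMap k r (continuous_comp_circleMap hkc hr0.le hr.2),
      lintegral_circle_eq_tsum hkc hk hr0.le hr.2, ← mul_assoc,
      ← ENNReal.ofReal_mul (by positivity), ← ENNReal.tsum_mul_left]
    refine tsum_congr fun n => ?_
    rw [← ENNReal.ofReal_mul (by positivity), ← ENNReal.ofReal_mul (by positivity)]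
    congr 1
    ring
  rw [setLIntegral_congr_fun measurableSet_Ioo h2, lintegral_tsum, ← ENNReal.tsum_mul_left]
  · refine tsum_congr fun n => ?_
    rw [lintegral_const_mul' _ _ ENNReal.ofReal_ne_top, lintegral_pow_mul_log,
      ← ENNReal.ofReal_inv_of_pos hpi, ← ENNReal.ofReal_mul (by positivity),
      ← ENNReal.ofReal_mul (by positivity)]
    congr 1
    field_simp
  · intro n
    fun_prop

/-! ### Möbius change of variables -/

/-- The involutive automorphism of `𝔻` exchanging `0` and `a`. -/
def moebius (a w : ℂ) : ℂ := (a - w) / (1 - conj a * w)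

lemma one_sub_conj_mul_ne_zero {a w : ℂ} (ha : ‖a‖ < 1) (hw : ‖w‖ < 1) :
    1 - conj a * w ≠ 0 := by
  intro h
  have h1 : conj a * w = 1 := (sub_eq_zero.1 h).symm
  have h2 : ‖a‖ * ‖w‖ = 1 := by
    rw [← Complex.norm_conj a, ← norm_mul, h1, norm_one]
  nlinarith [norm_nonneg a, norm_nonneg w]

lemma norm_sq_one_sub_conj_mul_sub (a w : ℂ) :
    ‖1 - conj a * w‖ ^ 2 - ‖a - w‖ ^ 2 = (1 - ‖a‖ ^ 2) * (1 - ‖w‖ ^ 2) := by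
  simp only [← Complex.normSq_eq_norm_sq, Complex.normSq_apply, Complex.sub_re, Complex.sub_im,
    Complex.mul_re, Complex.mul_im, Complex.conj_re, Complex.conj_im, Complex.one_re,
    Complex.one_im]
  ring

lemma norm_moebius_lt_one {a w : ℂ} (ha : ‖a‖ < 1) (hw : ‖w‖ < 1) : ‖moebius a w‖ < 1 := by
  have hne := norm_pos_iff.2 (one_sub_conj_mul_ne_zero ha hw)
  rw [moebius, norm_div, div_lt_one hne]
  have := norm_sq_one_sub_conj_mul_sub a w
  have h1 : 0 < (1 - ‖a‖ ^ 2) * (1 - ‖w‖ ^ 2) := by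
    refine mul_pos ?_ ?_ <;> nlinarith [norm_nonneg a, norm_nonneg w]
  exact lt_of_pow_lt_pow_left₀ 2 hne.le (by linarith)

lemma one_sub_conj_mul_moebius {a w : ℂ} (ha : ‖a‖ < 1) (hw : ‖w‖ < 1) :
    1 - conj a * moebius a w = (1 - conj a * a) / (1 - conj a * w) := by
  have hne := one_sub_conj_mul_ne_zero ha hw
  rw [moebius]
  field_simp
  ring

lemma moebius_moebius {a w : ℂ} (ha : ‖a‖ < 1) (hw : ‖w‖ < 1) :
    moebius a (moebius a w) = w := by
  have hne := one_sub_conj_mul_ne_zero ha hw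
  have hne' := one_sub_conj_mul_ne_zero ha ha
  have h : a - moebius a w = w * (1 - conj a * a) / (1 - conj a * w) := by
    rw [moebius, eq_div_iff hne, sub_mul, div_mul_cancel₀ _ hne]
    ring
  rw [moebius, one_sub_conj_mul_moebius ha hw, h, div_div_div_cancel_right₀ hne,
    mul_div_cancel_right₀ _ hne']

lemma hasDerivAt_moebius {a w : ℂ} (ha : ‖a‖ < 1) (hw : ‖w‖ < 1) :
    HasDerivAt (moebius a) (-(1 - conj a * a) / (1 - conj a * w) ^ 2) w := by
  have hne := one_sub_conj_mul_ne_zero ha hw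
  have h := ((hasDerivAt_id w).const_sub a).div
    (((hasDerivAt_id w).const_mul (conj a)).const_sub 1) hne
  convert! h using 1
  simp only [id]
  ring

lemma image_moebius {a : ℂ} (ha : ‖a‖ < 1) : moebius a '' ball 0 1 = ball 0 1 := by
  ext z
  constructor
  · rintro ⟨w, hw, rfl⟩
    rw [mem_ball_zero_iff] at hw ⊢
    exact norm_moebius_lt_one ha hw
  · intro hz
    rw [mem_ball_zero_iff] at hz
    exact ⟨moebius a z, mem_ball_zero_iff.2 (norm_moebius_lt_one ha hz), moebius_moebius ha hz⟩

/-- The weight at `a` is log |`moebius a`|⁻², and `moebius a` is an involution. At `w = 0` both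
sides vanish through division by zero. -/
lemma greenWeight_moebius {a w : ℂ} (ha : ‖a‖ < 1) (hw : ‖w‖ < 1) :
    greenWeight a (moebius a w) = greenWeight 0 w := by
  have h := moebius_moebius ha hw
  rw [moebius] at h
  have h2 : (1 - conj a * moebius a w) / (a - moebius a w) = w⁻¹ := by
    rw [← h, inv_div]; simp only [h]
  rw [greenWeight, greenWeight, h2]
  simp

lemma abs_det_smulRight_complex (c : ℂ) :
    |((ContinuousLinearMap.toSpanSingleton ℂ c).restrictScalars ℝ).det| = ‖c‖ ^ 2 := by
  rw [ContinuousLinearMap.det]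
  have : (((ContinuousLinearMap.toSpanSingleton ℂ c).restrictScalars ℝ : ℂ →L[ℝ] ℂ) : ℂ →ₗ[ℝ] ℂ)
      = (ContinuousLinearMap.toSpanSingleton ℂ c : ℂ →ₗ[ℂ] ℂ).restrictScalars ℝ := rfl
  rw [this, LinearMap.det_restrictScalars]
  simp [Algebra.norm_complex_apply, Complex.normSq_eq_norm_sq, LinearMap.det_ring]

/-- Conformal invariance of Green integrals. -/
lemma lintegral_greenWeight_eq {a : ℂ} (ha : ‖a‖ < 1) (k : ℂ → ℂ) :
    ∫⁻ z, ‖k z‖ₑ ^ 2 * greenWeight a z ∂diskArea =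
      ∫⁻ w, ‖k (moebius a w) * (-(1 - conj a * a) / (1 - conj a * w) ^ 2)‖ₑ ^ 2 *
        greenWeight 0 w ∂diskArea := by
  rw [lintegral_diskArea, lintegral_diskArea]
  congr 1
  have hinj : InjOn (moebius a) (ball 0 1) := by
    intro x hx y hy hxy
    rw [mem_ball_zero_iff] at hx hy
    rw [← moebius_moebius ha hx, hxy, moebius_moebius ha hy]
  conv_lhs => rw [← image_moebius ha]
  rw [lintegral_image_eq_lintegral_abs_det_fderiv_mul volume measurableSet_ball
    (fun w hw => ((hasDerivAt_moebius ha
      (mem_ball_zero_iff.1 hw)).hasFDerivAt.restrictScalars ℝ).hasFDerivWithinAt) hinj]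
  refine setLIntegral_congr_fun measurableSet_ball fun w hw => ?_
  rw [mem_ball_zero_iff] at hw
  rw [abs_det_smulRight_complex, greenWeight_moebius ha hw, enorm_mul, mul_pow,
    ENNReal.ofReal_pow (norm_nonneg _), ofReal_norm]
  ring


/-! ### Green integrals of log(1/(1 - z)) and of the identity -/

lemma one_sub_ne_zero_of_norm_lt_one {a : ℂ} (ha : ‖a‖ < 1) : 1 - a ≠ 0 := by
  intro h
  rw [← sub_eq_zero.1 h, norm_one] at ha
  exact lt_irrefl _ ha

lemma hasSum_geometric_shift {μ w : ℂ} (h : ‖μ * w‖ < 1) :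
    HasSum (fun n : ℕ => μ ^ (n + 1) * w ^ n) (μ / (1 - μ * w)) := by
  have := (hasSum_geometric_of_norm_lt_one h).mul_left μ
  convert! this using 1
  ext n
  rw [mul_pow]; ring

/-- The Green integral of `log (1 / (1 - z))`, as a series. -/
lemma lintegral_inv_one_sub_greenWeight {a : ℂ} (ha : ‖a‖ < 1) :
    ∫⁻ z, ‖(1 - z)⁻¹‖ₑ ^ 2 * greenWeight a z ∂diskArea =
      ∑' n : ℕ, ENNReal.ofReal
        (‖1 - (-(conj a * (1 - a) / (1 - conj a))) ^ (n + 1)‖ ^ 2 / ((n : ℝ) + 1) ^ 2) := by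
  have ha' : ‖conj a‖ < 1 := by rwa [Complex.norm_conj]
  have h1 := one_sub_ne_zero_of_norm_lt_one ha
  have h1' := one_sub_ne_zero_of_norm_lt_one ha'
  -- 1/μ is `moebius a 1`, the point of the unit circle that the pole 1 is pulled back to. The
  -- pulled-back derivative is then a difference of two geometric series, with ratios μ and `conj
  -- a`.
  set μ : ℂ := -((1 - conj a) / (1 - a)) with hμ
  have hμn : ‖μ‖ = 1 := by
    rw [hμ, norm_neg, norm_div, ← Complex.norm_conj (1 - a)]
    simp only [map_sub, map_one]
    exact div_self (norm_ne_zero_iff.2 h1')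
  have hμ0 : μ ≠ 0 := norm_ne_zero_iff.1 (by rw [hμn]; exact one_ne_zero)
  have hpull : ∀ w : ℂ, ‖w‖ < 1 →
      (1 - moebius a w)⁻¹ * (-(1 - conj a * a) / (1 - conj a * w) ^ 2) =
        μ / (1 - μ * w) - conj a / (1 - conj a * w) := by
    intro w hw
    have h2 := one_sub_conj_mul_ne_zero ha hw
    have h3 : 1 - μ * w ≠ 0 := by
      refine one_sub_ne_zero_of_norm_lt_one ?_
      rwa [norm_mul, hμn, one_mul]
    have h4 : 1 - moebius a w = (1 - a) * (1 - μ * w) / (1 - conj a * w) := by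
      rw [moebius, hμ, eq_div_iff h2, sub_mul, div_mul_cancel₀ _ h2]
      field_simp
      ring
    have h5 : (1 - conj a * a) = -((μ - conj a) * (1 - a)) := by
      rw [hμ]
      field_simp
      ring
    have h6 : μ * (1 - conj a * w) - (1 - μ * w) * conj a = μ - conj a := by ring
    rw [h4, h5, div_sub_div _ _ h3 h2, h6, inv_div, neg_neg]
    generalize 1 - conj a * w = D at *
    generalize 1 - μ * w = B at *
    field_simp
  have hcont : ContinuousOn
      (fun w => μ / (1 - μ * w) - conj a / (1 - conj a * w)) (ball 0 1) := by
    refine ContinuousOn.sub ?_ ?_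
    · refine ContinuousOn.div (by fun_prop) (by fun_prop) fun w hw => ?_
      refine one_sub_ne_zero_of_norm_lt_one ?_
      rw [norm_mul, hμn, one_mul]
      exact mem_ball_zero_iff.1 hw
    · exact ContinuousOn.div (by fun_prop) (by fun_prop)
        fun w hw => one_sub_conj_mul_ne_zero ha (mem_ball_zero_iff.1 hw)
  have hsum : ∀ w ∈ ball (0 : ℂ) 1, HasSum (fun n : ℕ => (μ ^ (n + 1) - conj a ^ (n + 1)) * w ^ n)
      (μ / (1 - μ * w) - conj a / (1 - conj a * w)) := by
    intro w hw
    rw [mem_ball_zero_iff] at hw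
    have := (hasSum_geometric_shift (μ := μ) (w := w) (by rwa [norm_mul, hμn, one_mul])).sub
      (hasSum_geometric_shift (μ := conj a) (w := w)
        (by rw [norm_mul]; exact mul_lt_one_of_nonneg_of_lt_one_left (norm_nonneg _) ha' hw.le))
    simpa only [sub_mul] using this
  rw [lintegral_greenWeight_eq ha]
  have : ∫⁻ w, ‖(1 - moebius a w)⁻¹ * (-(1 - conj a * a) / (1 - conj a * w) ^ 2)‖ₑ ^ 2 *
        greenWeight 0 w ∂diskArea =
      ∫⁻ w, ‖μ / (1 - μ * w) - conj a / (1 - conj a * w)‖ₑ ^ 2 * greenWeight 0 w ∂diskArea := by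
    rw [lintegral_diskArea, lintegral_diskArea]
    congr 1
    refine setLIntegral_congr_fun measurableSet_ball fun w hw => ?_
    rw [hpull w (mem_ball_zero_iff.1 hw)]
  rw [this, lintegral_greenWeight_zero hcont hsum]
  refine tsum_congr fun n => ?_
  -- Since |μ| = 1, factoring out μ^(n+1) leaves a series in the single parameter `conj a / μ`.
  have hc : -(conj a * (1 - a) / (1 - conj a)) = conj a / μ := by
    rw [hμ]
    field_simp
  have h6 : μ ^ (n + 1) - conj a ^ (n + 1) = μ ^ (n + 1) * (1 - (conj a / μ) ^ (n + 1)) := by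
    rw [div_pow]
    field_simp
  rw [hc, h6, norm_mul, norm_pow, hμn, one_pow, one_mul]

lemma norm_one_sub_exp_sq (t : ℝ) :
    ‖1 - Complex.exp (t * Complex.I)‖ ^ 2 = 2 - 2 * Real.cos t := by
  rw [← Complex.normSq_eq_norm_sq, Complex.normSq_apply]
  simp only [Complex.sub_re, Complex.sub_im, Complex.one_re, Complex.one_im,
    Complex.exp_ofReal_mul_I_re, Complex.exp_ofReal_mul_I_im]
  nlinarith [Real.sin_sq_add_cos_sq t]

/-- Since |1 - e^{it}|² = 2 - 2 cos t, the sum is 2ζ(2) minus twice the cosine series of the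
Bernoulli polynomial B₂, that is, π²/3 - 2π²(x² - x + 1/6). -/
lemma hasSum_norm_one_sub_exp_pow {x : ℝ} (hx : x ∈ Icc (0 : ℝ) 1) :
    HasSum (fun n : ℕ => ‖1 - Complex.exp ((2 * Real.pi * x : ℝ) * Complex.I) ^ (n + 1)‖ ^ 2 /
      ((n : ℝ) + 1) ^ 2) (2 * Real.pi ^ 2 * (x * (1 - x))) := by
  have h1 := hasSum_one_div_nat_pow_mul_cos one_ne_zero hx
  have h2 := (hasSum_zeta_two.mul_left 2).sub (h1.mul_left 2)
  -- The index shift costs nothing: the terms at 0 vanish because 1/0 = 0.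
  have h3 := (hasSum_nat_add_iff' 1).2 h2
  convert! h3 using 1
  · ext n
    rw [← Complex.exp_nat_mul, ← mul_assoc]
    have : ((n + 1 : ℕ) : ℂ) * ((2 * Real.pi * x : ℝ) : ℂ) =
      ((2 * Real.pi * (n + 1 : ℕ) * x : ℝ) : ℂ) := by push_cast; ring
    rw [this, norm_one_sub_exp_sq]
    push_cast
    ring
  · have hB : (Polynomial.map (algebraMap ℚ ℝ) (Polynomial.bernoulli (2 * 1))).eval x =
        x ^ 2 - x + 6⁻¹ := bernoulliFun_two x
    rw [hB]
    simp [Nat.factorial]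
    ring

lemma exists_eq_exp_of_norm_eq_one {c : ℂ} (hc : ‖c‖ = 1) :
    ∃ x ∈ Icc (0 : ℝ) 1, c = Complex.exp ((2 * Real.pi * x : ℝ) * Complex.I) := by
  have hpi := Real.pi_pos
  obtain ⟨t, ht⟩ := (Complex.norm_eq_one_iff c).1 hc
  refine ⟨Int.fract (t / (2 * Real.pi)), ⟨Int.fract_nonneg _, (Int.fract_lt_one _).le⟩, ?_⟩
  rw [← ht, Complex.exp_eq_exp_iff_exists_int]
  refine ⟨⌊t / (2 * Real.pi)⌋, ?_⟩
  rw [Int.fract]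
  push_cast
  have : (Real.pi : ℂ) ≠ 0 := by exact_mod_cast hpi.ne'
  field_simp
  ring

lemma sum_norm_one_sub_pow_le_of_norm_eq_one {c : ℂ} (hc : ‖c‖ = 1) (N : ℕ) :
    ∑ n ∈ Finset.range N, ‖1 - c ^ (n + 1)‖ ^ 2 / ((n : ℝ) + 1) ^ 2 ≤ Real.pi ^ 2 / 2 := by
  obtain ⟨x, hx, rfl⟩ := exists_eq_exp_of_norm_eq_one hc
  refine (sum_le_hasSum _ (fun n _ => by positivity) (hasSum_norm_one_sub_exp_pow hx)).trans ?_
  have := mul_nonneg (sq_nonneg Real.pi) (sq_nonneg (2 * x - 1))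
  nlinarith

/-- A partial sum is the squared norm of a polynomial map into a Hilbert space, so the vector-valued
maximum principle carries the bound from the unit circle to the disc. -/
lemma sum_norm_one_sub_pow_le {c : ℂ} (hc : ‖c‖ ≤ 1) (N : ℕ) :
    ∑ n ∈ Finset.range N, ‖1 - c ^ (n + 1)‖ ^ 2 / ((n : ℝ) + 1) ^ 2 ≤ Real.pi ^ 2 / 2 := by
  set F : ℂ → EuclideanSpace ℂ (Fin N) := fun c =>
    WithLp.toLp 2 fun n : Fin N => (1 - c ^ ((n : ℕ) + 1)) / ((n : ℕ) + 1) with hF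
  have hnorm : ∀ c, ‖F c‖ ^ 2 =
      ∑ n ∈ Finset.range N, ‖1 - c ^ (n + 1)‖ ^ 2 / ((n : ℝ) + 1) ^ 2 := by
    intro c
    rw [EuclideanSpace.norm_sq_eq, Finset.sum_range]
    refine Finset.sum_congr rfl fun n _ => ?_
    simp only [hF, norm_div, div_pow]
    congr 2
    rw [← Nat.cast_add_one, Complex.norm_natCast]
    push_cast; rfl
  have hdiff : Differentiable ℂ F := by
    rw [differentiable_euclidean]
    intro i
    simp only [hF]
    fun_prop
  have hfr : ∀ z ∈ frontier (ball (0 : ℂ) 1), ‖F z‖ ≤ Real.sqrt (Real.pi ^ 2 / 2) := by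
    intro z hz
    rw [frontier_ball _ one_ne_zero, mem_sphere_zero_iff_norm] at hz
    refine Real.le_sqrt_of_sq_le ?_
    rw [hnorm]
    exact sum_norm_one_sub_pow_le_of_norm_eq_one hz N
  have hcl : c ∈ closure (ball (0 : ℂ) 1) := by
    rw [closure_ball _ one_ne_zero]
    simpa using hc
  have := Complex.norm_le_of_forall_mem_frontier_norm_le isBounded_ball hdiff.diffContOnCl hfr hcl
  rw [← hnorm]
  exact (Real.le_sqrt (norm_nonneg _) (by positivity)).1 this

/-- The Green integrals of `log (1 / (1 - z))` are at most `π² / 2`. -/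
lemma lintegral_inv_one_sub_greenWeight_le {a : ℂ} (ha : ‖a‖ < 1) :
    ∫⁻ z, ‖(1 - z)⁻¹‖ₑ ^ 2 * greenWeight a z ∂diskArea ≤ ENNReal.ofReal (Real.pi ^ 2 / 2) := by
  rw [lintegral_inv_one_sub_greenWeight ha]
  refine ENNReal.tsum_le_of_sum_range_le fun N => ?_
  rw [← ENNReal.ofReal_sum_of_nonneg fun n _ => by positivity]
  refine ENNReal.ofReal_le_ofReal (sum_norm_one_sub_pow_le ?_ N)
  have h1 : ‖1 - conj a‖ = ‖1 - a‖ := by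
    rw [← Complex.norm_conj (1 - a)]; simp
  rw [norm_neg, norm_div, norm_mul, h1, Complex.norm_conj,
    mul_div_cancel_right₀ _ (norm_ne_zero_iff.2 (one_sub_ne_zero_of_norm_lt_one ha))]
  exact ha.le

/-- For real `a = r` the parameter of the series is `-r`. At -1 the full sum is π²/2, so some
partial sum exceeds `B` there, and by continuity also for `r` near 1. -/
lemma eventually_le_lintegral_inv_one_sub_greenWeight {B : ℝ} (hB : B < Real.pi ^ 2 / 2) :
    ∀ᶠ r : ℝ in 𝓝[<] 1,
      ENNReal.ofReal B ≤ ∫⁻ z, ‖(1 - z)⁻¹‖ₑ ^ 2 * greenWeight (r : ℂ) z ∂diskArea := by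
  have h1 := hasSum_norm_one_sub_exp_pow (x := 1 / 2) ⟨by norm_num, by norm_num⟩
  have h2 : Complex.exp ((2 * Real.pi * (1 / 2) : ℝ) * Complex.I) = -1 := by
    rw [show 2 * Real.pi * (1 / 2) = Real.pi by ring, Complex.exp_pi_mul_I]
  rw [h2, show 2 * Real.pi ^ 2 * (1 / 2 * (1 - 1 / 2)) = Real.pi ^ 2 / 2 by ring] at h1
  obtain ⟨N, hN⟩ := (h1.tendsto_sum_nat.eventually (lt_mem_nhds hB)).exists
  have hc : Continuous fun r : ℝ =>
      ∑ n ∈ Finset.range N, ‖1 - (-(r : ℂ)) ^ (n + 1)‖ ^ 2 / ((n : ℝ) + 1) ^ 2 := by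
    fun_prop
  have h3 := hc.tendsto 1
  simp only [Complex.ofReal_one] at h3
  filter_upwards [(h3.mono_left nhdsWithin_le_nhds).eventually (lt_mem_nhds hN),
    Ioo_mem_nhdsLT (zero_lt_one' ℝ)] with r hr hr01
  have hr1 : ‖(r : ℂ)‖ < 1 := by
    rw [Complex.norm_real, Real.norm_of_nonneg hr01.1.le]; exact hr01.2
  have hne := one_sub_ne_zero_of_norm_lt_one hr1
  rw [lintegral_inv_one_sub_greenWeight hr1, Complex.conj_ofReal, mul_div_cancel_right₀ _ hne]
  refine le_trans ?_ (ENNReal.sum_le_tsum (Finset.range N))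
  rw [← ENNReal.ofReal_sum_of_nonneg fun n _ => by positivity]
  exact ENNReal.ofReal_le_ofReal hr.le

/-- The Green integral of the identity. -/
lemma lintegral_greenWeight {a : ℂ} (ha : ‖a‖ < 1) :
    ∫⁻ z, greenWeight a z ∂diskArea = ENNReal.ofReal (1 - ‖a‖ ^ 2) := by
  have ha' : ‖conj a‖ < 1 := by rwa [Complex.norm_conj]
  have hlt : ‖a‖ ^ 2 < 1 := by nlinarith [norm_nonneg a]
  have hcont : ContinuousOn (fun w => -(1 - conj a * a) / (1 - conj a * w) ^ 2) (ball 0 1) := by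
    refine ContinuousOn.div (by fun_prop) (by fun_prop) fun w hw => ?_
    exact pow_ne_zero _ (one_sub_conj_mul_ne_zero ha (mem_ball_zero_iff.1 hw))
  have hsum : ∀ w ∈ ball (0 : ℂ) 1,
      HasSum (fun n : ℕ => (-(1 - conj a * a) * ((n + 1) * conj a ^ n)) * w ^ n)
        (-(1 - conj a * a) / (1 - conj a * w) ^ 2) := by
    intro w hw
    rw [mem_ball_zero_iff] at hw
    have h := (hasSum_choose_mul_geometric_of_norm_lt_one (𝕜 := ℂ) 1 (r := conj a * w)
      (by rw [norm_mul]; exact mul_lt_one_of_nonneg_of_lt_one_left (norm_nonneg _) ha' hw.le)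
      ).mul_left (-(1 - conj a * a))
    convert! h using 1
    · ext n
      rw [Nat.choose_one_right, mul_pow]
      push_cast
      ring
    · ring
  -- Conformal invariance reduces the claim to the Taylor coefficients of the derivative of `moebius
  -- a`.
  have h := lintegral_greenWeight_eq ha (fun _ => 1)
  simp only [enorm_one, one_pow, one_mul] at h
  rw [h, lintegral_greenWeight_zero hcont hsum]
  have hs := (hasSum_geometric_of_lt_one (sq_nonneg ‖a‖) hlt).mul_left ((1 - ‖a‖ ^ 2) ^ 2)
  have hval : (1 - ‖a‖ ^ 2) ^ 2 * (1 - ‖a‖ ^ 2)⁻¹ = 1 - ‖a‖ ^ 2 := by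
    have : 1 - ‖a‖ ^ 2 ≠ 0 := by linarith
    field_simp
  rw [hval] at hs
  rw [← hs.tsum_eq, ENNReal.ofReal_tsum_of_nonneg (fun n => by positivity) hs.summable]
  refine tsum_congr fun n => ?_
  congr 1
  have hn : ‖((n : ℂ) + 1)‖ = n + 1 := by
    rw [← Nat.cast_add_one, Complex.norm_natCast]; push_cast; rfl
  have h1 : ‖1 - conj a * a‖ = 1 - ‖a‖ ^ 2 := by
    rw [Complex.conj_mul', ← Complex.ofReal_pow, ← Complex.ofReal_one, ← Complex.ofReal_sub,
      Complex.norm_real, Real.norm_of_nonneg (by linarith)]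
  rw [norm_mul, norm_neg, h1, norm_mul, norm_pow, hn, Complex.norm_conj]
  have : (n : ℝ) + 1 ≠ 0 := by positivity
  field_simp
  ring


/-! ### Power series in the disc -/

lemma summable_norm_mul_pow_of_hasSum {h : ℂ → ℂ} {e : ℕ → ℂ}
    (hh : ∀ z ∈ ball (0 : ℂ) 1, HasSum (fun n => e n * z ^ n) (h z)) {r : ℝ}
    (hr0 : 0 ≤ r) (hr1 : r < 1) : Summable fun n => ‖e n‖ * r ^ n := by
  convert! summable_norm_mul_pow hh hr0 hr1 using 1
  ext n
  rw [norm_mul, norm_pow, Complex.norm_real, Real.norm_of_nonneg hr0]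

lemma differentiableAt_and_hasSum_deriv {h : ℂ → ℂ} {e : ℕ → ℂ}
    (hh : ∀ z ∈ ball (0 : ℂ) 1, HasSum (fun n => e n * z ^ n) (h z)) {z : ℂ}
    (hz : z ∈ ball (0 : ℂ) 1) : DifferentiableAt ℂ h z ∧
      HasSum (fun n : ℕ => ((n : ℂ) + 1) * e (n + 1) * z ^ n) (deriv h z) := by
  rw [mem_ball_zero_iff] at hz
  obtain ⟨r, hzr, hr1⟩ := exists_between hz
  have hr0 : 0 ≤ r := (norm_nonneg z).trans hzr.le
  have hu := summable_norm_mul_pow_of_hasSum hh hr0 hr1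
  have hzm : z ∈ ball (0 : ℂ) r := mem_ball_zero_iff.2 hzr
  have hd : ∀ n : ℕ, DifferentiableOn ℂ (fun w : ℂ => e n * w ^ n) (ball 0 r) := by
    intro n; fun_prop
  have hb : ∀ (n : ℕ) (w : ℂ), w ∈ ball (0 : ℂ) r → ‖e n * w ^ n‖ ≤ ‖e n‖ * r ^ n := by
    intro n w hw
    rw [mem_ball_zero_iff] at hw
    rw [norm_mul, norm_pow]
    gcongr
  have heq : h =ᶠ[𝓝 z] fun w => ∑' n, e n * w ^ n := by
    filter_upwards [isOpen_ball.mem_nhds hzm] with w hw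
    exact (hh w (ball_subset_ball hr1.le hw)).tsum_eq.symm
  refine ⟨(((Complex.differentiableOn_tsum_of_summable_norm hu hd isOpen_ball hb).differentiableAt
    (isOpen_ball.mem_nhds hzm)).congr_of_eventuallyEq heq), ?_⟩
  have hs := Complex.hasSum_deriv_of_summable_norm hu hd isOpen_ball hb hzm
  rw [← heq.deriv_eq] at hs
  have hs' := (hasSum_nat_add_iff' 1).2 hs
  simp only [Finset.sum_range_one, pow_zero, mul_one, deriv_const, sub_zero] at hs'
  convert! hs' using 1
  ext n
  rw [deriv_const_mul_field, deriv_pow_field]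
  simp
  ring

/-! ### Bounded holomorphic functions -/

lemma hasSum_taylorCoeff {f : ℂ → ℂ} (hf : Hol f) {z : ℂ} (hz : z ∈ ball (0 : ℂ) 1) :
    HasSum (fun k => taylorCoeff f k * z ^ k) (f z) := by
  convert! Complex.hasSum_taylorSeries_on_ball hf hz using 1
  ext k
  simp only [taylorCoeff, sub_zero, smul_eq_mul]
  ring

variable {f : ℂ → ℂ} {M : ℝ}

/-- Parseval on |z| = r bounds every partial sum by M², uniformly in r; then r → 1. -/
lemma summable_norm_sq_taylorCoeff (hf : Hol f) (hM : ∀ z ∈ ball (0 : ℂ) 1, ‖f z‖ ≤ M) :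
    Summable fun k => ‖taylorCoeff f k‖ ^ 2 := by
  refine summable_of_sum_range_le (c := M ^ 2) (fun k => by positivity) fun N => ?_
  have hc : Continuous fun r : ℝ => ∑ k ∈ Finset.range N, ‖taylorCoeff f k‖ ^ 2 * r ^ (2 * k) := by
    fun_prop
  have ht := (hc.tendsto 1).mono_left (nhdsWithin_le_nhds (s := Iio 1))
  simp only [one_pow, mul_one] at ht
  refine le_of_tendsto ht ?_
  filter_upwards [Ioo_mem_nhdsLT (zero_lt_one' ℝ)] with r hr
  have h1 := hasSum_norm_sq_circleAverage_radius (fun z hz => hasSum_taylorCoeff hf hz) hr.1.le hr.2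
  refine (sum_le_hasSum _ (fun k _ => ?_) h1).trans ?_
  · have := hr.1
    positivity
  · refine Real.circleAverage_mono_on_of_le_circle ?_ fun z hz => ?_
    · exact ((continuous_comp_circleMap hf.continuousOn hr.1.le hr.2).norm.pow
        2).intervalIntegrable _ _
    · rw [mem_sphere_zero_iff_norm, abs_of_nonneg hr.1.le] at hz
      have := hM z (mem_ball_zero_iff.2 (hz ▸ hr.2))
      gcongr

/-- Both factors are square-summable in `k`, so 2xy ≤ x² + y² suffices. -/
lemma summable_norm_hilbertTerm (hf : Hol f) (hM : ∀ z ∈ ball (0 : ℂ) 1, ‖f z‖ ≤ M) (n : ℕ) :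
    Summable fun k : ℕ => ‖taylorCoeff f k‖ * (1 / ((k : ℝ) + n + 1)) := by
  have h1 := summable_norm_sq_taylorCoeff hf hM
  have h2 : Summable fun k : ℕ => 1 / ((k : ℝ) + 1) ^ 2 := by
    have := (summable_nat_add_iff 1).2 (Real.summable_one_div_nat_pow.2 (one_lt_two))
    simpa using this
  refine Summable.of_nonneg_of_le (fun k => by positivity) (fun k => ?_) (h1.add h2)
  have h3 : 1 / ((k : ℝ) + n + 1) ≤ 1 / ((k : ℝ) + 1) := by
    apply one_div_le_one_div_of_le (by positivity)
    have : (0 : ℝ) ≤ n := by positivity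
    linarith
  have h4 : (1 / ((k : ℝ) + 1)) ^ 2 = 1 / ((k : ℝ) + 1) ^ 2 := by rw [div_pow, one_pow]
  have h5 := two_mul_le_add_sq ‖taylorCoeff f k‖ (1 / ((k : ℝ) + 1))
  have h6 : 0 ≤ ‖taylorCoeff f k‖ * (1 / ((k : ℝ) + 1)) := by positivity
  have h7 := mul_le_mul_of_nonneg_left h3 (norm_nonneg (taylorCoeff f k))
  linarith

lemma mem_ball_of_mem_Ioo {s : ℝ} (hs : s ∈ Ioo (0 : ℝ) 1) : (s : ℂ) ∈ ball (0 : ℂ) 1 := by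
  rw [mem_ball_zero_iff, Complex.norm_real, Real.norm_of_nonneg hs.1.le]
  exact hs.2

lemma integrableOn_Ioo_of_bound {g : ℝ → ℂ} {C : ℝ} (hg : ContinuousOn g (Ioo 0 1))
    (hC : ∀ s ∈ Ioo (0 : ℝ) 1, ‖g s‖ ≤ C) : IntegrableOn g (Ioo 0 1) := by
  refine IntegrableOn.of_bound (by simp) (hg.aestronglyMeasurable measurableSet_Ioo) C ?_
  exact (ae_restrict_iff' measurableSet_Ioo).2 (Eventually.of_forall hC)

lemma continuousOn_ofReal (hf : Hol f) : ContinuousOn (fun s : ℝ => f s) (Ioo 0 1) :=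
  hf.continuousOn.comp Complex.continuous_ofReal.continuousOn fun _ hs => mem_ball_of_mem_Ioo hs

lemma integral_Ioo_pow (m : ℕ) : ∫ s in Ioo (0 : ℝ) 1, s ^ m = 1 / ((m : ℝ) + 1) := by
  rw [← integral_Ioc_eq_integral_Ioo, ← intervalIntegral.integral_of_le zero_le_one, integral_pow]
  simp

/-- The coefficients of `H(f)` are the moments of `f` on `(0, 1)`. -/
lemma hasSum_hilbertTerm (hf : Hol f) (hM : ∀ z ∈ ball (0 : ℂ) 1, ‖f z‖ ≤ M) (n : ℕ) :
    HasSum (hilbertTerm f n) (∫ s in Ioo (0 : ℝ) 1, (s : ℂ) ^ n * f s) := by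
  have hint : ∀ k, IntegrableOn (fun s : ℝ => taylorCoeff f k * (s : ℂ) ^ (k + n)) (Ioo 0 1) := by
    intro k
    refine integrableOn_Ioo_of_bound (C := ‖taylorCoeff f k‖) (by fun_prop) fun s hs => ?_
    rw [norm_mul, norm_pow]
    refine mul_le_of_le_one_right (norm_nonneg _) (pow_le_one₀ (norm_nonneg _) ?_)
    exact (mem_ball_zero_iff.1 (mem_ball_of_mem_Ioo hs)).le
  have hnorm : ∀ k, ∫ s in Ioo (0 : ℝ) 1, ‖taylorCoeff f k * (s : ℂ) ^ (k + n)‖ =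
      ‖taylorCoeff f k‖ * (1 / ((k : ℝ) + n + 1)) := by
    intro k
    have : ∫ s in Ioo (0 : ℝ) 1, ‖taylorCoeff f k * (s : ℂ) ^ (k + n)‖ =
        ∫ s in Ioo (0 : ℝ) 1, ‖taylorCoeff f k‖ * s ^ (k + n) := by
      refine setIntegral_congr_fun measurableSet_Ioo fun s hs => ?_
      rw [norm_mul, norm_pow, Complex.norm_real, Real.norm_of_nonneg hs.1.le]
    rw [this, integral_const_mul, integral_Ioo_pow]
    push_cast; rfl
  have hval : ∀ k, ∫ s in Ioo (0 : ℝ) 1, taylorCoeff f k * (s : ℂ) ^ (k + n) =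
      hilbertTerm f n k := by
    intro k
    have h1 : ∫ s in Ioo (0 : ℝ) 1, (s : ℂ) ^ (k + n) = ((1 / ((k + n : ℕ) + 1) : ℝ) : ℂ) := by
      rw [← integral_Ioo_pow, ← integral_complex_ofReal]
      push_cast; rfl
    rw [integral_const_mul, h1, hilbertTerm]
    push_cast
    ring
  have h := hasSum_integral_of_summable_integral_norm hint
    (by simp_rw [hnorm]; exact summable_norm_hilbertTerm hf hM n)
  simp_rw [hval] at h
  convert! h using 1
  refine setIntegral_congr_fun measurableSet_Ioo fun s hs => ?_
  rw [← (hasSum_taylorCoeff hf (mem_ball_of_mem_Ioo hs)).tsum_eq, ← tsum_mul_left]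
  refine tsum_congr fun k => ?_
  ring

lemma hilbertCoeff_eq (hf : Hol f) (hM : ∀ z ∈ ball (0 : ℂ) 1, ‖f z‖ ≤ M) (n : ℕ) :
    hilbertCoeff f n = ∫ s in Ioo (0 : ℝ) 1, (s : ℂ) ^ n * f s :=
  (hasSum_hilbertTerm hf hM n).tsum_eq

lemma norm_pow_mul_le (hM : ∀ z ∈ ball (0 : ℂ) 1, ‖f z‖ ≤ M) (n : ℕ) {s : ℝ}
    (hs : s ∈ Ioo (0 : ℝ) 1) : ‖(s : ℂ) ^ n * f s‖ ≤ M := by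
  have h := mem_ball_of_mem_Ioo hs
  have hs' := mem_ball_zero_iff.1 h
  rw [norm_mul, norm_pow]
  exact (mul_le_of_le_one_left (norm_nonneg _) (pow_le_one₀ (norm_nonneg _) hs'.le)).trans (hM _ h)

lemma norm_hilbertCoeff_le (hf : Hol f) (hM : ∀ z ∈ ball (0 : ℂ) 1, ‖f z‖ ≤ M) (n : ℕ) :
    ‖hilbertCoeff f n‖ ≤ M := by
  rw [hilbertCoeff_eq hf hM]
  have := norm_setIntegral_le_of_norm_le_const (μ := volume) (s := Ioo (0 : ℝ) 1) (C := M)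
    (f := fun s : ℝ => (s : ℂ) ^ n * f s) (by simp) (fun s hs => norm_pow_mul_le hM n hs)
  simpa using this

lemma summable_hilbertCoeff (hf : Hol f) (hM : ∀ z ∈ ball (0 : ℂ) 1, ‖f z‖ ≤ M) {z : ℂ}
    (hz : z ∈ ball (0 : ℂ) 1) : Summable fun n => hilbertCoeff f n * z ^ n := by
  rw [mem_ball_zero_iff] at hz
  refine Summable.of_norm_bounded
    ((summable_geometric_of_lt_one (norm_nonneg z) hz).mul_left M) fun n => ?_
  rw [norm_mul, norm_pow]
  gcongr
  exact norm_hilbertCoeff_le hf hM n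

lemma hasSum_hilbertOp (hf : Hol f) (hM : ∀ z ∈ ball (0 : ℂ) 1, ‖f z‖ ≤ M) {z : ℂ}
    (hz : z ∈ ball (0 : ℂ) 1) : HasSum (fun n => hilbertCoeff f n * z ^ n) (hilbertOp f z) :=
  (summable_hilbertCoeff hf hM hz).hasSum

lemma one_sub_mul_ne_zero {s z : ℂ} (hs : ‖s‖ < 1) (hz : ‖z‖ < 1) : 1 - s * z ≠ 0 := by
  have := one_sub_conj_mul_ne_zero (a := conj s) (by rwa [Complex.norm_conj]) hz
  rwa [Complex.conj_conj] at this

lemma one_sub_norm_le_norm_one_sub_mul {s z : ℂ} (hs : ‖s‖ ≤ 1) : 1 - ‖z‖ ≤ ‖1 - s * z‖ := by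
  have h := norm_sub_norm_le (1 : ℂ) (s * z)
  rw [norm_one, norm_mul] at h
  have := mul_le_of_le_one_left (norm_nonneg z) hs
  linarith

lemma norm_hilbertKernel_le (hM : ∀ z ∈ ball (0 : ℂ) 1, ‖f z‖ ≤ M) {s z : ℂ}
    (hs : ‖s‖ < 1) (hz : ‖z‖ < 1) : ‖s * f s / (1 - s * z) ^ 2‖ ≤ M / (1 - ‖z‖) ^ 2 := by
  have h0 : 0 < 1 - ‖z‖ := by linarith
  have h1 := one_sub_norm_le_norm_one_sub_mul (z := z) hs.le
  have h2 := hM s (mem_ball_zero_iff.2 hs)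
  rw [norm_div, norm_pow, norm_mul]
  have hM0 : 0 ≤ M := (norm_nonneg _).trans h2
  gcongr
  exact (mul_le_of_le_one_left (norm_nonneg _) hs.le).trans h2

/-- The coefficients are moments of `f`; summation and integration are exchanged, and ∑ (n+1)(sz)ⁿ =
(1 - sz)⁻² is recognised. -/
lemma deriv_hilbertOp_eq (hf : Hol f) (hM : ∀ z ∈ ball (0 : ℂ) 1, ‖f z‖ ≤ M) {z : ℂ}
    (hz : ‖z‖ < 1) :
    deriv (hilbertOp f) z = ∫ s in Ioo (0 : ℝ) 1, (s : ℂ) * f s / (1 - s * z) ^ 2 := by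
  have h1 := (differentiableAt_and_hasSum_deriv (fun z hz => hasSum_hilbertOp hf hM hz)
    (mem_ball_zero_iff.2 hz)).2
  have hM0 : 0 ≤ M := (norm_nonneg _).trans (hM 0 (by simp))
  have hb : ∀ n : ℕ, ∀ s ∈ Ioo (0 : ℝ) 1,
      ‖((n : ℂ) + 1) * z ^ n * ((s : ℂ) ^ (n + 1) * f s)‖ ≤ ((n : ℝ) + 1) * ‖z‖ ^ n * M := by
    intro n s hs
    rw [norm_mul, norm_mul, norm_pow]
    gcongr
    · rw [← Nat.cast_add_one, Complex.norm_natCast]; push_cast; rfl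
    · exact norm_pow_mul_le hM _ hs
  have hcont := continuousOn_ofReal hf
  have hint : ∀ n : ℕ, IntegrableOn
      (fun s : ℝ => ((n : ℂ) + 1) * z ^ n * ((s : ℂ) ^ (n + 1) * f s)) (Ioo 0 1) :=
    fun n => integrableOn_Ioo_of_bound
      (ContinuousOn.mul (by fun_prop) (ContinuousOn.mul (by fun_prop) hcont)) (hb n)
  have hgeo : Summable fun n : ℕ => ((n : ℝ) + 1) * ‖z‖ ^ n * M := by
    have := (hasSum_choose_mul_geometric_of_norm_lt_one (𝕜 := ℝ) 1 (r := ‖z‖)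
      (by simpa using hz)).summable
    simp only [Nat.choose_one_right] at this
    push_cast at this
    exact this.mul_right M
  have hsum : Summable fun n : ℕ =>
      ∫ s in Ioo (0 : ℝ) 1, ‖((n : ℂ) + 1) * z ^ n * ((s : ℂ) ^ (n + 1) * f s)‖ := by
    refine Summable.of_nonneg_of_le (fun n => integral_nonneg fun s => norm_nonneg _)
      (fun n => ?_) hgeo
    have := norm_setIntegral_le_of_norm_le_const (μ := volume) (s := Ioo (0 : ℝ) 1)
      (C := ((n : ℝ) + 1) * ‖z‖ ^ n * M)
      (f := fun s : ℝ => ‖((n : ℂ) + 1) * z ^ n * ((s : ℂ) ^ (n + 1) * f s)‖) (by simp)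
      (fun s hs => by rw [norm_norm]; exact hb n s hs)
    refine (le_abs_self _).trans ?_
    simpa using this
  have h2 := hasSum_integral_of_summable_integral_norm hint hsum
  have h3 : ∀ n : ℕ, ∫ s in Ioo (0 : ℝ) 1, ((n : ℂ) + 1) * z ^ n * ((s : ℂ) ^ (n + 1) * f s) =
      ((n : ℂ) + 1) * hilbertCoeff f (n + 1) * z ^ n := by
    intro n
    rw [integral_const_mul, hilbertCoeff_eq hf hM]
    ring
  simp_rw [h3] at h2
  rw [h1.unique h2]
  refine setIntegral_congr_fun measurableSet_Ioo fun s hs => ?_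
  have hs1 := mem_ball_zero_iff.1 (mem_ball_of_mem_Ioo hs)
  have h4 := ((hasSum_choose_mul_geometric_of_norm_lt_one (𝕜 := ℂ) 1 (r := s * z)
      (by rw [norm_mul]; exact mul_lt_one_of_nonneg_of_lt_one_left (norm_nonneg _) hs1 hz.le)
      ).mul_right ((s : ℂ) * f s)).tsum_eq
  simp only [Nat.choose_one_right] at h4
  rw [show (s : ℂ) * f s / (1 - s * z) ^ 2 = 1 / (1 - s * z) ^ (1 + 1) * (s * f s) by ring, ← h4]
  refine tsum_congr fun n => ?_
  push_cast
  ring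


/-! ### Contour deformation and the pointwise bound for the derivative -/

/-- The curve `t ↦ t / (1 - (1 - t) z)` from `0` to `1`, along which `dζ / (1 - ζ z)²` is
`dt / (1 - z)`. -/
def hilbertPath (z : ℂ) (t : ℝ) : ℂ := t / (1 - (1 - t) * z)

/-- This keeps the curve inside the disc: |1 - (1 - t)z| ≥ 1 - (1 - t)|z| > t. -/
lemma hilbertPath_denom_gt {z : ℂ} (hz : ‖z‖ < 1) {t : ℝ} (h1 : t < 1) :
    t < ‖1 - (1 - (t : ℂ)) * z‖ := by
  have h := norm_sub_norm_le (1 : ℂ) ((1 - (t : ℂ)) * z)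
  have h2 : ‖1 - (t : ℂ)‖ = 1 - t := by
    rw [← Complex.ofReal_one, ← Complex.ofReal_sub, Complex.norm_real,
      Real.norm_of_nonneg (by linarith)]
  rw [norm_one, norm_mul, h2] at h
  nlinarith

lemma hilbertPath_denom_ne_zero {z : ℂ} (hz : ‖z‖ < 1) {t : ℝ} (h0 : 0 ≤ t) (h1 : t ≤ 1) :
    1 - (1 - (t : ℂ)) * z ≠ 0 := by
  refine one_sub_ne_zero_of_norm_lt_one ?_
  have h2 : ‖1 - (t : ℂ)‖ = 1 - t := by
    rw [← Complex.ofReal_one, ← Complex.ofReal_sub, Complex.norm_real,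
      Real.norm_of_nonneg (by linarith)]
  rw [norm_mul, h2]
  nlinarith [norm_nonneg z]

lemma norm_hilbertPath_lt_one {z : ℂ} (hz : ‖z‖ < 1) {t : ℝ} (h0 : 0 ≤ t) (h1 : t < 1) :
    ‖hilbertPath z t‖ < 1 := by
  have h := hilbertPath_denom_gt hz h1
  rw [hilbertPath, norm_div, Complex.norm_real, Real.norm_of_nonneg h0,
    div_lt_one (h0.trans_lt h)]
  exact h

lemma hasDerivAt_hilbertPath {z : ℂ} (hz : ‖z‖ < 1) {t : ℝ} (h0 : 0 ≤ t) (h1 : t ≤ 1) :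
    HasDerivAt (hilbertPath z) ((1 - z) / (1 - (1 - (t : ℂ)) * z) ^ 2) t := by
  have hne := hilbertPath_denom_ne_zero hz h0 h1
  have hid : HasDerivAt (fun s : ℝ => (s : ℂ)) 1 t := Complex.ofRealCLM.hasDerivAt
  have h := hid.div (((hid.const_sub 1).mul_const z).const_sub 1) hne
  refine h.congr_deriv ?_
  ring

lemma one_sub_hilbertPath_mul {z : ℂ} (hz : ‖z‖ < 1) {t : ℝ} (h0 : 0 ≤ t) (h1 : t ≤ 1) :
    1 - hilbertPath z t * z = (1 - z) / (1 - (1 - (t : ℂ)) * z) := by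
  have hne := hilbertPath_denom_ne_zero hz h0 h1
  rw [hilbertPath, eq_div_iff hne, sub_mul, div_mul_eq_mul_div, div_mul_cancel₀ _ hne]
  ring

/-- The key pointwise estimate: `|H(f)'(z)| ≤ ‖f‖_∞ / |1 - z|`. -/
lemma norm_deriv_hilbertOp_le (hf : Hol f) (hM : ∀ z ∈ ball (0 : ℂ) 1, ‖f z‖ ≤ M) {z : ℂ}
    (hz : ‖z‖ < 1) : ‖deriv (hilbertOp f) z‖ ≤ M * ‖(1 - z)⁻¹‖ := by
  have hM0 : 0 ≤ M := (norm_nonneg _).trans (hM 0 (by simp))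
  have h1z := one_sub_ne_zero_of_norm_lt_one hz
  set G : ℂ → ℂ := fun s => s * f s / (1 - s * z) ^ 2 with hG
  set C : ℝ := M / (1 - ‖z‖) ^ 2 with hC
  have hGb : ∀ s ∈ ball (0 : ℂ) 1, ‖G s‖ ≤ C := fun s hs =>
    norm_hilbertKernel_le hM (mem_ball_zero_iff.1 hs) hz
  have hGd : DifferentiableOn ℂ G (ball 0 1) := by
    have : DifferentiableOn ℂ f (ball 0 1) := hf
    refine DifferentiableOn.div (by fun_prop) (by fun_prop) fun s hs => ?_
    exact pow_ne_zero _ (one_sub_mul_ne_zero (mem_ball_zero_iff.1 hs) hz)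
  -- With a primitive `Q`, integrals of `G` depend only on endpoints, which permits changing the
  -- contour. The common endpoint 1 lies outside the open disc, so both contours are stopped at
  -- parameter `r < 1`.
  obtain ⟨Q, hQ⟩ := hGd.isExactOn_ball
  have hGc : ContinuousOn (fun s : ℝ => G s) (Ioo 0 1) :=
    hGd.continuousOn.comp Complex.continuous_ofReal.continuousOn
      fun _ hs => mem_ball_of_mem_Ioo hs
  have hint : IntegrableOn (fun s : ℝ => G s) (Ioo 0 1) :=
    integrableOn_Ioo_of_bound hGc fun s hs => hGb _ (mem_ball_of_mem_Ioo hs)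
  have hint' : IntegrableOn (fun s : ℝ => G s) (uIcc 0 1) := by
    rw [uIcc_of_le zero_le_one, integrableOn_Icc_iff_integrableOn_Ioo]
    exact hint
  have hQint : ∀ r ∈ Ioo (0 : ℝ) 1, ∫ s in (0 : ℝ)..r, G s = Q r - Q 0 := by
    intro r hr
    have := intervalIntegral.integral_eq_sub_of_hasDerivAt (a := 0) (b := r)
      (f := fun s : ℝ => Q s) (f' := fun s : ℝ => G s) (fun s hs => ?_) ?_
    · simpa using this
    · rw [uIcc_of_le hr.1.le] at hs
      refine (hQ _ ?_).comp_ofReal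
      rw [mem_ball_zero_iff, Complex.norm_real, Real.norm_of_nonneg hs.1]
      exact hs.2.trans_lt hr.2
    · refine (hint'.mono_set ?_).intervalIntegrable
      exact uIcc_subset_uIcc left_mem_uIcc (by rw [uIcc_of_le zero_le_one]; exact ⟨hr.1.le, hr.2.le⟩)
  have hpath : ∀ r ∈ Ioo (0 : ℝ) 1, ‖Q (hilbertPath z r) - Q 0‖ ≤ M * ‖(1 - z)⁻¹‖ := by
    intro r hr
    have h0 : hilbertPath z 0 = 0 := by simp [hilbertPath]
    have hd : ∀ t ∈ Icc 0 r, HasDerivWithinAt (fun t : ℝ => Q (hilbertPath z t))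
        (G (hilbertPath z t) * ((1 - z) / (1 - (1 - (t : ℂ)) * z) ^ 2)) (Icc 0 r) t := by
      intro t ht
      have ht1 : t < 1 := ht.2.trans_lt hr.2
      exact ((hQ _ (mem_ball_zero_iff.2 (norm_hilbertPath_lt_one hz ht.1 ht1))).comp t
        (hasDerivAt_hilbertPath hz ht.1 ht1.le)).hasDerivWithinAt
    have hb : ∀ t ∈ Ico 0 r,
        ‖G (hilbertPath z t) * ((1 - z) / (1 - (1 - (t : ℂ)) * z) ^ 2)‖ ≤ M * ‖(1 - z)⁻¹‖ := by
      intro t ht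
      have ht1 : t < 1 := ht.2.trans hr.2
      have hne := hilbertPath_denom_ne_zero hz ht.1 ht1.le
      have hlt := norm_hilbertPath_lt_one hz ht.1 ht1
      have heq : G (hilbertPath z t) * ((1 - z) / (1 - (1 - (t : ℂ)) * z) ^ 2) =
          hilbertPath z t * f (hilbertPath z t) * (1 - z)⁻¹ := by
        simp only [hG]
        rw [one_sub_hilbertPath_mul hz ht.1 ht1.le]
        generalize hilbertPath z t = ζ
        generalize 1 - (1 - (t : ℂ)) * z = D at *
        field_simp
      rw [heq, norm_mul, norm_mul]
      gcongr
      exact (mul_le_of_le_one_left (norm_nonneg _) hlt.le).trans (hM _ (mem_ball_zero_iff.2 hlt))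
    have h := norm_image_sub_le_of_norm_deriv_le_segment' hd hb r ⟨hr.1.le, le_rfl⟩
    simp only [h0, sub_zero] at h
    exact h.trans (mul_le_of_le_one_right (by positivity) hr.2.le)
  -- The stopped contours end at different points, but `Q` is Lipschitz because `G` is bounded, and
  -- both endpoints tend to 1.
  have hclose : ∀ r ∈ Ioo (0 : ℝ) 1, ‖Q r - Q (hilbertPath z r)‖ ≤ C * ‖(r : ℂ) - hilbertPath z r‖ :=
    fun r hr => Convex.norm_image_sub_le_of_norm_hasDerivWithin_le
      (fun s hs => (hQ s hs).hasDerivWithinAt) hGb (convex_ball 0 1)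
      (mem_ball_zero_iff.2 (norm_hilbertPath_lt_one hz hr.1.le hr.2)) (mem_ball_of_mem_Ioo hr)
  have hbound : ∀ r ∈ Ioo (0 : ℝ) 1, ‖∫ s in (0 : ℝ)..r, G s‖ ≤
      M * ‖(1 - z)⁻¹‖ + C * ‖(r : ℂ) - hilbertPath z r‖ := by
    intro r hr
    rw [hQint r hr, show Q r - Q 0 = (Q (hilbertPath z r) - Q 0) + (Q r - Q (hilbertPath z r)) by ring]
    exact (norm_add_le _ _).trans (add_le_add (hpath r hr) (hclose r hr))
  have hlim1 : Tendsto (fun r : ℝ => ‖∫ s in (0 : ℝ)..r, G s‖) (𝓝[Ioo 0 1] 1)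
      (𝓝 ‖∫ s in (0 : ℝ)..1, G s‖) := by
    have := intervalIntegral.continuousOn_primitive_interval hint' 1 right_mem_uIcc
    rw [uIcc_of_le zero_le_one] at this
    exact (this.mono Ioo_subset_Icc_self).tendsto.norm
  have hlim2 : Tendsto (fun r : ℝ => M * ‖(1 - z)⁻¹‖ + C * ‖(r : ℂ) - hilbertPath z r‖)
      (𝓝[Ioo 0 1] 1) (𝓝 (M * ‖(1 - z)⁻¹‖)) := by
    have h1 : hilbertPath z 1 = 1 := by simp [hilbertPath]
    have h2 := (hasDerivAt_hilbertPath hz zero_le_one le_rfl).continuousAt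
    have h3 : ContinuousAt
        (fun r : ℝ => M * ‖(1 - z)⁻¹‖ + C * ‖(r : ℂ) - hilbertPath z r‖) 1 := by fun_prop
    have h4 := h3.tendsto
    simp only [h1, Complex.ofReal_one, sub_self, norm_zero, mul_zero, add_zero] at h4
    exact h4.mono_left nhdsWithin_le_nhds
  have : (𝓝[Ioo (0 : ℝ) 1] 1).NeBot := by
    rw [nhdsWithin_Ioo_eq_nhdsLT zero_lt_one]
    infer_instance
  rw [deriv_hilbertOp_eq hf hM hz, ← integral_Ioc_eq_integral_Ioo,
    ← intervalIntegral.integral_of_le zero_le_one]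
  refine le_of_tendsto_of_tendsto hlim1 hlim2 ?_
  filter_upwards [self_mem_nhdsWithin] with r hr using hbound r hr


/-! ### The upper bound and membership in BMOA -/

lemma MemHInf.norm_le {f : ℂ → ℂ} (hf : MemHInf f) :
    ∀ z ∈ ball (0 : ℂ) 1, ‖f z‖ ≤ (hInfNorm f).toReal := by
  intro z hz
  rw [← toReal_enorm]
  refine ENNReal.toReal_mono hf.2.ne ?_
  exact le_iSup₂ (f := fun z (_ : z ∈ ball (0 : ℂ) 1) => ‖f z‖ₑ) z hz

lemma greenIntegral_eq (f : ℂ → ℂ) (a : ℂ) :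
    greenIntegral f a = ∫⁻ z, ‖deriv f z‖ₑ ^ 2 * greenWeight a z ∂diskArea := rfl

lemma lintegral_diskArea_mono {F G : ℂ → ℝ≥0∞} (h : ∀ z, ‖z‖ < 1 → F z ≤ G z) :
    ∫⁻ z, F z ∂diskArea ≤ ∫⁻ z, G z ∂diskArea := by
  rw [lintegral_diskArea, lintegral_diskArea]
  exact mul_le_mul_right (setLIntegral_mono' measurableSet_ball
    fun z hz => h z (mem_ball_zero_iff.1 hz)) _

lemma greenIntegral_hilbertOp_le (hf : Hol f) (hM : ∀ z ∈ ball (0 : ℂ) 1, ‖f z‖ ≤ M) {a : ℂ}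
    (ha : ‖a‖ < 1) :
    greenIntegral (hilbertOp f) a ≤ ENNReal.ofReal (M ^ 2 * (Real.pi ^ 2 / 2)) := by
  have hM0 : 0 ≤ M := (norm_nonneg _).trans (hM 0 (by simp))
  have h1 : greenIntegral (hilbertOp f) a ≤
      ∫⁻ z, ENNReal.ofReal (M ^ 2) * (‖(1 - z)⁻¹‖ₑ ^ 2 * greenWeight a z) ∂diskArea := by
    rw [greenIntegral_eq]
    refine lintegral_diskArea_mono fun z hz => ?_
    rw [← mul_assoc]
    gcongr
    have h := norm_deriv_hilbertOp_le hf hM hz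
    rw [← ofReal_norm, ← ofReal_norm, ← ENNReal.ofReal_pow (norm_nonneg _),
      ← ENNReal.ofReal_pow (norm_nonneg _), ← ENNReal.ofReal_mul (by positivity), ← mul_pow]
    gcongr
  refine h1.trans ?_
  rw [lintegral_const_mul' _ _ ENNReal.ofReal_ne_top, ENNReal.ofReal_mul (by positivity)]
  gcongr
  exact lintegral_inv_one_sub_greenWeight_le ha

lemma hilbertOp_zero (hf : Hol f) (hM : ∀ z ∈ ball (0 : ℂ) 1, ‖f z‖ ≤ M) :
    hilbertOp f 0 = hilbertCoeff f 0 := by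
  have h := hasSum_hilbertOp hf hM (z := 0) (by simp)
  refine h.unique ?_
  convert! hasSum_single (f := fun n => hilbertCoeff f n * (0 : ℂ) ^ n) 0 ?_ using 1
  · simp
  · intro n hn
    simp [hn]

lemma ofReal_rpow_half {x y : ℝ} (hy : 0 ≤ y) (h : x = y ^ 2) :
    ENNReal.ofReal x ^ (1 / 2 : ℝ) = ENNReal.ofReal y := by
  rw [h, ENNReal.ofReal_rpow_of_nonneg (by positivity) (by norm_num), ← Real.sqrt_eq_rpow,
    Real.sqrt_sq hy]

lemma bmoaNorm_hilbertOp_le (hf : Hol f) (hM : ∀ z ∈ ball (0 : ℂ) 1, ‖f z‖ ≤ M) :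
    bmoaNorm (hilbertOp f) ≤ ENNReal.ofReal (1 + Real.pi / Real.sqrt 2) * ENNReal.ofReal M := by
  have hpi := Real.pi_pos
  have hM0 : 0 ≤ M := (norm_nonneg _).trans (hM 0 (by simp))
  have h1 : ‖hilbertOp f 0‖ₑ ≤ ENNReal.ofReal M := by
    rw [hilbertOp_zero hf hM, ← ofReal_norm]
    exact ENNReal.ofReal_le_ofReal (norm_hilbertCoeff_le hf hM 0)
  have h2 : (⨆ a ∈ ball (0 : ℂ) 1, greenIntegral (hilbertOp f) a) ^ (1 / 2 : ℝ) ≤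
      ENNReal.ofReal (M * (Real.pi / Real.sqrt 2)) := by
    rw [← ofReal_rpow_half (x := M ^ 2 * (Real.pi ^ 2 / 2)) (by positivity)
      (by rw [mul_pow, div_pow, Real.sq_sqrt zero_le_two])]
    gcongr
    exact iSup₂_le fun a ha => greenIntegral_hilbertOp_le hf hM (mem_ball_zero_iff.1 ha)
  rw [← ENNReal.ofReal_mul (by positivity),
    show (1 + Real.pi / Real.sqrt 2) * M = M + M * (Real.pi / Real.sqrt 2) by ring,
    ENNReal.ofReal_add hM0 (by positivity)]
  exact add_le_add h1 h2

lemma hol_hilbertOp (hf : Hol f) (hM : ∀ z ∈ ball (0 : ℂ) 1, ‖f z‖ ≤ M) : Hol (hilbertOp f) :=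
  fun _ hz => (differentiableAt_and_hasSum_deriv
    (fun _ hw => hasSum_hilbertOp hf hM hw) hz).1.differentiableWithinAt

/-- By Littlewood–Paley the Green integral at `a = 0` is the sum of |coefficient|² over indices at
least 1; only the constant term has to be added. -/
lemma tsum_norm_sq_hilbertCoeff_lt_top (hf : Hol f) (hM : ∀ z ∈ ball (0 : ℂ) 1, ‖f z‖ ≤ M) :
    ∑' n, ENNReal.ofReal (‖hilbertCoeff f n‖ ^ 2) < ∞ := by
  have hc : ContinuousOn (deriv (hilbertOp f)) (ball 0 1) :=
    (DifferentiableOn.deriv (hol_hilbertOp hf hM) isOpen_ball).continuousOn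
  have h1 := lintegral_greenWeight_zero hc fun z hz =>
    (differentiableAt_and_hasSum_deriv (fun _ hw => hasSum_hilbertOp hf hM hw) hz).2
  have h2 := greenIntegral_hilbertOp_le hf hM (a := 0) (by simp)
  rw [greenIntegral_eq, h1] at h2
  rw [tsum_eq_zero_add' ENNReal.summable]
  refine ENNReal.add_lt_top.2 ⟨ENNReal.ofReal_lt_top,
    lt_of_le_of_lt (le_trans (le_of_eq (tsum_congr fun n => ?_)) h2) ENNReal.ofReal_lt_top⟩
  have hn : ‖((n : ℂ) + 1)‖ = n + 1 := by
    rw [← Nat.cast_add_one, Complex.norm_natCast]; push_cast; rfl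
  have : (n : ℝ) + 1 ≠ 0 := by positivity
  rw [norm_mul, hn]
  congr 1
  field_simp

lemma memHardy_hilbertOp (hf : Hol f) (hM : ∀ z ∈ ball (0 : ℂ) 1, ‖f z‖ ≤ M) :
    MemHardy 2 (hilbertOp f) := by
  have hpi := Real.pi_pos
  refine ⟨hol_hilbertOp hf hM, ?_⟩
  refine lt_of_le_of_lt (b := (∑' n, ENNReal.ofReal (‖hilbertCoeff f n‖ ^ 2)) ^ (1 / 2 : ℝ)) ?_
    (ENNReal.rpow_lt_top_of_nonneg (by norm_num) (tsum_norm_sq_hilbertCoeff_lt_top hf hM).ne)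
  refine iSup₂_le fun r hr => ?_
  rw [integralMean]
  gcongr
  have h1 : ∀ θ : ℝ, (r : ℂ) * Complex.exp ((θ : ℂ) * Complex.I) = circleMap 0 r θ := by
    intro θ; simp [circleMap]
  simp only [h1, ENNReal.rpow_two]
  rw [lintegral_circle_eq_tsum (hol_hilbertOp hf hM).continuousOn
    (fun z hz => hasSum_hilbertOp hf hM hz) hr.1 hr.2, ← mul_assoc, ENNReal.inv_mul_cancel
    (by simpa using hpi) ENNReal.ofReal_ne_top, one_mul]
  refine ENNReal.tsum_le_tsum fun n => ENNReal.ofReal_le_ofReal ?_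
  exact mul_le_of_le_one_right (by positivity) (pow_le_one₀ hr.1 hr.2.le)

/-! ### The extremal function -/

lemma norm_one_fun_le : ∀ z ∈ ball (0 : ℂ) 1, ‖(fun _ => 1 : ℂ → ℂ) z‖ ≤ 1 := by
  simp

lemma hol_one : Hol (fun _ => 1) := differentiableOn_const 1

lemma hilbertCoeff_one (n : ℕ) : hilbertCoeff (fun _ => 1) n = 1 / ((n : ℂ) + 1) := by
  rw [hilbertCoeff_eq hol_one norm_one_fun_le]
  have h1 : ∫ s in Ioo (0 : ℝ) 1, (s : ℂ) ^ n = ((1 / ((n : ℝ) + 1) : ℝ) : ℂ) := by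
    rw [← integral_Ioo_pow, ← integral_complex_ofReal]
    push_cast; rfl
  simp only [mul_one]
  rw [h1]
  push_cast; rfl

lemma hInfNorm_one : hInfNorm (fun _ => 1) = 1 := by
  refine le_antisymm (iSup₂_le fun z _ => by simp) ?_
  refine le_trans ?_ (le_iSup₂ (f := fun z (_ : z ∈ ball (0 : ℂ) 1) => ‖(1 : ℂ)‖ₑ) 0 (by simp))
  simp

lemma hasSum_one_div_mul_succ :
    HasSum (fun n : ℕ => 1 / (((n : ℝ) + 1) * ((n : ℝ) + 2))) 1 := by
  rw [hasSum_iff_tendsto_nat_of_nonneg (fun n => by positivity)]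
  have h : ∀ N : ℕ, ∑ n ∈ Finset.range N, 1 / (((n : ℝ) + 1) * ((n : ℝ) + 2)) =
      1 - 1 / ((N : ℝ) + 1) := by
    intro N
    induction N with
    | zero => simp
    | succ N ih =>
      rw [Finset.sum_range_succ, ih]
      push_cast
      field_simp
      ring
  simp_rw [h]
  simpa using (tendsto_one_div_add_atTop_nhds_zero_nat (𝕜 := ℝ)).const_sub 1

/-- Multiplication by 1 - z takes differences of coefficients: (n+1)/(n+2) - n/(n+1). These are
absolutely summable, which gives continuity up to the boundary. -/
lemma one_sub_mul_deriv_hilbertOp_one {z : ℂ} (hz : ‖z‖ < 1) :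
    (1 - z) * deriv (hilbertOp fun _ => 1) z =
      ∑' n : ℕ, ((1 / (((n : ℝ) + 1) * ((n : ℝ) + 2)) : ℝ) : ℂ) * z ^ n := by
  have h := (differentiableAt_and_hasSum_deriv
    (fun _ hw => hasSum_hilbertOp hol_one norm_one_fun_le hw) (mem_ball_zero_iff.2 hz)).2
  generalize deriv (hilbertOp fun _ => 1) z = S at h
  simp only [hilbertCoeff_one] at h
  have h1 : HasSum (fun n : ℕ => ((n : ℂ) / (n + 1)) * z ^ n) (z * S) := by
    refine (hasSum_nat_add_iff' 1).1 ?_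
    convert! h.mul_left z using 1
    · ext n
      push_cast
      rw [pow_succ]
      ring
    · simp
  rw [sub_mul, one_mul]
  rw [← (h.sub h1).tsum_eq]
  refine tsum_congr fun n => ?_
  have hn1 : (n : ℂ) + 1 ≠ 0 := by exact_mod_cast n.succ_ne_zero
  have hn2 : (n : ℂ) + 2 ≠ 0 := by exact_mod_cast (n + 1).succ_ne_zero
  push_cast
  rw [show (n : ℂ) + 1 + 1 = n + 2 by ring]
  field_simp
  ring

/-- Near 1 the function `m` has squared modulus above 1 - ε; at distance at least δ from 1 the left
side is at most δ⁻², absorbed by `C`. -/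
lemma exists_norm_sq_inv_one_sub_le {ε : ℝ} (hε : 0 < ε) :
    ∃ C : ℝ, 0 ≤ C ∧ ∀ z : ℂ, ‖z‖ < 1 →
      (1 - ε) * ‖(1 - z)⁻¹‖ ^ 2 ≤ ‖deriv (hilbertOp fun _ => 1) z‖ ^ 2 + C := by
  set m : ℂ → ℂ := fun z => ∑' n : ℕ, ((1 / (((n : ℝ) + 1) * ((n : ℝ) + 2)) : ℝ) : ℂ) * z ^ n
    with hm
  have hcont : ContinuousOn m (closedBall 0 1) := by
    refine continuousOn_tsum (fun n => by fun_prop) hasSum_one_div_mul_succ.summable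
      fun n z hz => ?_
    rw [mem_closedBall_zero_iff] at hz
    rw [norm_mul, norm_pow, Complex.norm_real, Real.norm_of_nonneg (by positivity)]
    exact mul_le_of_le_one_right (by positivity) (pow_le_one₀ (norm_nonneg _) hz)
  have hm1 : m 1 = 1 := by
    simp only [hm, one_pow, mul_one]
    rw [← Complex.ofReal_tsum, hasSum_one_div_mul_succ.tsum_eq, Complex.ofReal_one]
  have h1 := (hcont 1 (by simp)).tendsto.norm.pow 2
  rw [hm1, norm_one, one_pow] at h1
  have h2 := h1.eventually (lt_mem_nhds (show 1 - ε < 1 by linarith))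
  obtain ⟨δ, hδ, hball⟩ := Metric.mem_nhdsWithin_iff.1 h2
  refine ⟨(δ⁻¹) ^ 2, by positivity, fun z hz => ?_⟩
  have hne := one_sub_ne_zero_of_norm_lt_one hz
  have hpos : 0 < ‖1 - z‖ := norm_pos_iff.2 hne
  by_cases hd : ‖1 - z‖ < δ
  · have h3 : 1 - ε < ‖m z‖ ^ 2 := by
      refine hball ⟨?_, mem_closedBall_zero_iff.2 hz.le⟩
      rwa [mem_ball, dist_comm, dist_eq_norm]
    have h4 : deriv (hilbertOp fun _ => 1) z = m z * (1 - z)⁻¹ := by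
      simp only [hm]
      rw [← one_sub_mul_deriv_hilbertOp_one hz]
      field_simp
    rw [h4, norm_mul, mul_pow]
    have h5 : 0 ≤ (δ⁻¹) ^ 2 := by positivity
    have h6 := mul_le_mul_of_nonneg_right h3.le (sq_nonneg ‖(1 - z)⁻¹‖)
    linarith
  · have h3 : ‖(1 - z)⁻¹‖ ≤ δ⁻¹ := by
      rw [norm_inv]
      exact inv_anti₀ hδ (not_lt.1 hd)
    have h4 : ‖(1 - z)⁻¹‖ ^ 2 ≤ (δ⁻¹) ^ 2 := by gcongr
    nlinarith [sq_nonneg ‖(1 - z)⁻¹‖, sq_nonneg ‖deriv (hilbertOp fun _ => 1) z‖]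

lemma le_iSup_greenIntegral_hilbertOp_one :
    ENNReal.ofReal (Real.pi ^ 2 / 2) ≤
      ⨆ a ∈ ball (0 : ℂ) 1, greenIntegral (hilbertOp fun _ => 1) a := by
  have hpi := Real.pi_pos
  set S := ⨆ a ∈ ball (0 : ℂ) 1, greenIntegral (hilbertOp fun _ => 1) a with hS
  -- One factor 1 - ε is lost in the pointwise comparison, the other in approaching π²/2. The error
  -- `C` integrates to C(1 - r²), which vanishes as r → 1.
  have key : ∀ ε ∈ Ioo (0 : ℝ) 1, ENNReal.ofReal ((1 - ε) * ((1 - ε) * (Real.pi ^ 2 / 2))) ≤ S := by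
    intro ε hε
    obtain ⟨C, hC, hCz⟩ := exists_norm_sq_inv_one_sub_le hε.1
    have hB : (1 - ε) * (Real.pi ^ 2 / 2) < Real.pi ^ 2 / 2 := by
      have : 0 < Real.pi ^ 2 / 2 := by positivity
      nlinarith [hε.1]
    have hev := eventually_le_lintegral_inv_one_sub_greenWeight hB
    have hlim : Tendsto (fun r : ℝ => S + ENNReal.ofReal (C * (1 - r ^ 2))) (𝓝[<] 1) (𝓝 S) := by
      have hc : Continuous fun r : ℝ => ENNReal.ofReal (C * (1 - r ^ 2)) :=
        ENNReal.continuous_ofReal.comp (by fun_prop)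
      have h := (hc.tendsto 1).const_add S
      simp only [one_pow, sub_self, mul_zero, ENNReal.ofReal_zero, add_zero] at h
      exact h.mono_left nhdsWithin_le_nhds
    refine ge_of_tendsto hlim ?_
    filter_upwards [hev, Ioo_mem_nhdsLT (zero_lt_one' ℝ)] with r hr hr01
    have hr1 : ‖(r : ℂ)‖ < 1 := mem_ball_zero_iff.1 (mem_ball_of_mem_Ioo hr01)
    have hnr : ‖(r : ℂ)‖ = r := by rw [Complex.norm_real, Real.norm_of_nonneg hr01.1.le]
    calc ENNReal.ofReal ((1 - ε) * ((1 - ε) * (Real.pi ^ 2 / 2)))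
        ≤ ENNReal.ofReal (1 - ε) *
          ∫⁻ z, ‖(1 - z)⁻¹‖ₑ ^ 2 * greenWeight (r : ℂ) z ∂diskArea := by
          rw [ENNReal.ofReal_mul (by linarith [hε.2])]
          gcongr
      _ = ∫⁻ z, ENNReal.ofReal (1 - ε) * (‖(1 - z)⁻¹‖ₑ ^ 2 * greenWeight (r : ℂ) z) ∂diskArea :=
          (lintegral_const_mul' _ _ ENNReal.ofReal_ne_top).symm
      _ ≤ ∫⁻ z, (‖deriv (hilbertOp fun _ => 1) z‖ₑ ^ 2 * greenWeight (r : ℂ) z +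
            ENNReal.ofReal C * greenWeight (r : ℂ) z) ∂diskArea := by
          refine lintegral_diskArea_mono fun z hz => ?_
          rw [← mul_assoc, ← add_mul]
          gcongr
          have h := hCz z hz
          rw [← ofReal_norm, ← ofReal_norm, ← ENNReal.ofReal_pow (norm_nonneg _),
            ← ENNReal.ofReal_pow (norm_nonneg _), ← ENNReal.ofReal_mul (by linarith [hε.2]),
            ← ENNReal.ofReal_add (by positivity) hC]
          exact ENNReal.ofReal_le_ofReal h
      _ = greenIntegral (hilbertOp fun _ => 1) r + ENNReal.ofReal (C * (1 - r ^ 2)) := by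
          rw [lintegral_add_right _ ((measurable_greenWeight _).const_mul _),
            lintegral_const_mul _ (measurable_greenWeight _), lintegral_greenWeight hr1, hnr,
            ← ENNReal.ofReal_mul hC, greenIntegral_eq]
      _ ≤ S + ENNReal.ofReal (C * (1 - r ^ 2)) := by
          gcongr
          exact le_iSup₂ (f := fun a (_ : a ∈ ball (0 : ℂ) 1) =>
            greenIntegral (hilbertOp fun _ => 1) a) (r : ℂ) (mem_ball_of_mem_Ioo hr01)
  have hc : Continuous fun ε : ℝ =>
      ENNReal.ofReal ((1 - ε) * ((1 - ε) * (Real.pi ^ 2 / 2))) :=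
    ENNReal.continuous_ofReal.comp (by fun_prop)
  have hl := (hc.tendsto 0).mono_left (nhdsWithin_le_nhds (s := Ioi 0))
  simp only [sub_zero, one_mul] at hl
  refine le_of_tendsto hl ?_
  filter_upwards [Ioo_mem_nhdsGT (zero_lt_one' ℝ)] with ε hε using key ε hε

lemma le_bmoaNorm_hilbertOp_one :
    ENNReal.ofReal (1 + Real.pi / Real.sqrt 2) ≤ bmoaNorm (hilbertOp fun _ => 1) := by
  have hpi := Real.pi_pos
  rw [ENNReal.ofReal_add zero_le_one (by positivity), bmoaNorm,
    hilbertOp_zero hol_one norm_one_fun_le, hilbertCoeff_one]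
  refine add_le_add (by simp) ?_
  rw [← ofReal_rpow_half (x := Real.pi ^ 2 / 2) (by positivity)
    (by rw [div_pow, Real.sq_sqrt zero_le_two])]
  gcongr
  exact le_iSup_greenIntegral_hilbertOp_one

end HilbertBMOA

end

/-- The Hilbert matrix operator is well defined on `H^∞` (all the series that define it converge),
it maps `H^∞` into `BMOA`, and its norm is `1 + π / √2`. -/
theorem theorem1p1 :
    (∀ f : ℂ → ℂ, HilbertBMOA.MemHInf f →
      (∀ n : ℕ, Summable (HilbertBMOA.hilbertTerm f n)) ∧
      (∀ z ∈ Metric.ball (0 : ℂ) 1,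
        Summable (fun n : ℕ => HilbertBMOA.hilbertCoeff f n * z ^ n)) ∧
      HilbertBMOA.MemBMOA (HilbertBMOA.hilbertOp f)) ∧
    HilbertBMOA.opNormHInfBMOA HilbertBMOA.hilbertOp =
      ENNReal.ofReal (1 + Real.pi / Real.sqrt 2) := by
  refine ⟨fun f hf => ⟨fun n => (HilbertBMOA.hasSum_hilbertTerm hf.1 hf.norm_le n).summable,
    fun z hz => HilbertBMOA.summable_hilbertCoeff hf.1 hf.norm_le hz,
    HilbertBMOA.memHardy_hilbertOp hf.1 hf.norm_le,
    (HilbertBMOA.bmoaNorm_hilbertOp_le hf.1 hf.norm_le).trans_lt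
      (ENNReal.mul_lt_top ENNReal.ofReal_lt_top ENNReal.ofReal_lt_top)⟩, le_antisymm ?_ ?_⟩
  · refine sInf_le fun f hf => ?_
    have h := HilbertBMOA.bmoaNorm_hilbertOp_le hf.1 hf.norm_le
    rwa [ENNReal.ofReal_toReal hf.2.ne] at h
  · refine le_sInf fun C hC => ?_
    have h := hC (fun _ => 1) ⟨HilbertBMOA.hol_one, by
      rw [HilbertBMOA.hInfNorm_one]; exact ENNReal.one_lt_top⟩
    rw [HilbertBMOA.hInfNorm_one, mul_one] at h
    exact HilbertBMOA.le_bmoaNorm_hilbertOp_one.trans h
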